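/- Let $n\ge 2$ and let $f:(0,\infty)\to(0,\infty)$ be a smooth function such that (i) $f'(K)>0$ for all $K>0$; (ii) there are constants $0<\alpha_1<\alpha_2\le n-1$ with $\alpha_1\le \frac{nKf'(K)-f(K)}{f(K)}\le\alpha_2$ for all $K>0$; (iii) there is a constant $\beta>0$ with $0<\frac{Kf''(K)}{f'(K)}+1-\frac1n\le\beta$ for all $K>0$; (iv) there are constants $\gamma,\hat\gamma>0$ with $\frac{K}{f(K)^{\gamma}}\ge\hat\gamma$ for all sufficiently large $K$; (v) $(\chi_1,\dots,\chi_n)\mapsto f\big(1/(\chi_1\cdots\chi_n)\big)$ is convex on $(0,\infty)^n$ (that is, $f(K)$ is convex as a function of the principal radii of curvature). Let $F_0:\mathbb S^n\to\mathbb R^{n+1}$ be a parametrization of a smooth, closed, strictly convex hypersurface, let $\vartheta>0$ and let $r_0>0$. Then there is a constant $C>0$, depending only on $n$, $f$, $\vartheta F_0$ and $r_0$, with the following property. Let $T\in(0,\infty]$ and let $F:\mathbb S^n\times[0,T)\to\mathbb R^{n+1}$ be a smooth family of parametrizations $F(\cdot,t)$ of smooth closed convex hypersurfaces $M_t$ with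 positive Gauss curvature $K(\cdot,t)$ which solves $$\frac{\partial F}{\partial t}(x,t)=-f(K(x,t))\,v(x,t),\qquad F(x,0)=\vartheta F_0(x),$$ where $v(x,t)$ is the unit outer normal of $M_t$ at $F(x,t)$. Suppose that for every $t\in[0,T)$ the inner radius of $M_t$ (the supremum of the radii of the balls contained in the convex body enclosed by $M_t$) is at least $r_0$. Then $$K(x,t)\le C\qquad\text{for all }x\in\mathbb S^n,\ t\in[0,T);$$ in particular the bound is independent of $t$. -/

import Mathlib

open Set Metric Filter Topology
open scoped Manifold ContDiff RealInnerProductSpace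

noncomputable section

namespace GaussFlow

/-- The Euclidean space `ℝ^{n+1}`. -/
abbrev Amb (n : ℕ) : Type := EuclideanSpace ℝ (Fin (n + 1))

/-- The unit sphere `S^n` in `ℝ^{n+1}`. -/
abbrev Sph (n : ℕ) : Type := sphere (0 : Amb n) 1

/-- The map `X : S^n → ℝ^{n+1}` read in the coordinate system `(x_1, …, x_n)` of `S^n` around
`x` (stereographic projection; its inverse is defined on all of `ℝ^n`). -/
def localRep {n : ℕ} (X : Sph n → Amb n) (x : Sph n) : EuclideanSpace ℝ (Fin n) → Amb n :=
  fun y => X ((extChartAt (𝓡 n) x).symm y)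

/-- The partial derivative `∂φ/∂x_i`. -/
def partialD {n : ℕ} (i : Fin n) (φ : EuclideanSpace ℝ (Fin n) → Amb n) :
    EuclideanSpace ℝ (Fin n) → Amb n :=
  fun y => fderiv ℝ φ y (EuclideanSpace.single i 1)

/-- `∂X/∂x_i` at the point `x`. -/
def coordD {n : ℕ} (X : Sph n → Amb n) (x : Sph n) (i : Fin n) : Amb n :=
  partialD i (localRep X x) (extChartAt (𝓡 n) x x)

/-- `∂²X/∂x_i∂x_j` at the point `x`. -/
def coordD2 {n : ℕ} (X : Sph n → Amb n) (x : Sph n) (i j : Fin n) : Amb n :=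
  partialD i (partialD j (localRep X x)) (extChartAt (𝓡 n) x x)

/-- `v` is the unit outer normal at `X x` of the convex hypersurface parametrized by `X`:
it is a unit vector, orthogonal to the tangent space, and the hypersurface lies
in the half-space `{z | ⟪z - X x, v⟫ ≤ 0}`. -/
def IsOuterUnitNormal {n : ℕ} (X : Sph n → Amb n) (x : Sph n) (v : Amb n) : Prop :=
  ‖v‖ = 1 ∧ (∀ i, ⟪coordD X x i, v⟫ = 0) ∧ ∀ y, ⟪X y - X x, v⟫ ≤ 0

/-- The unit outer normal at `X x` (it exists and is unique if `X` parametrizes a convex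
hypersurface in the sense of `IsConvexHypersurface`). -/
def outerNormal {n : ℕ} (X : Sph n → Amb n) (x : Sph n) : Amb n :=
  Classical.epsilon (IsOuterUnitNormal X x)

/-- The induced metric `g_ij = ⟪∂X/∂x_i, ∂X/∂x_j⟫` at `x`. -/
def metricMatrix {n : ℕ} (X : Sph n → Amb n) (x : Sph n) : Matrix (Fin n) (Fin n) ℝ :=
  Matrix.of fun i j => ⟪coordD X x i, coordD X x j⟫

/-- The second fundamental form `h_ij = -⟪∂²X/∂x_i∂x_j, v⟫` at `x`. -/
def secondForm {n : ℕ} (X : Sph n → Amb n) (x : Sph n) : Matrix (Fin n) (Fin n) ℝ :=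
  Matrix.of fun i j => -⟪coordD2 X x i j, outerNormal X x⟫

/-- The Gauss curvature `K = det h_ij / det g_ij` at `x`; the quotient does not depend on the
coordinates. -/
def gaussCurvature {n : ℕ} (X : Sph n → Amb n) (x : Sph n) : ℝ :=
  (secondForm X x).det / (metricMatrix X x).det

/-- The convex body enclosed by a convex hypersurface. -/
def enclosedBody {n : ℕ} (X : Sph n → Amb n) : Set (Amb n) :=
  convexHull ℝ (range X)

/-- `X : S^n → ℝ^{n+1}` is a parametrization of a smooth closed convex hypersurface: a smooth
injective immersion whose image is the boundary of a convex body with interior points. -/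
structure IsConvexHypersurface {n : ℕ} (X : Sph n → Amb n) : Prop where
  smooth : ContMDiff (𝓡 n) 𝓘(ℝ, Amb n) ∞ X
  injective : Function.Injective X
  immersion : ∀ x, LinearIndependent ℝ (coordD X x)
  interior_nonempty : (interior (enclosedBody X)).Nonempty
  range_eq : range X = frontier (enclosedBody X)

/-- A smooth closed convex hypersurface is strictly convex if its second fundamental form is
positive definite. -/
structure IsStrictlyConvexHypersurface {n : ℕ} (X : Sph n → Amb n) : Prop extends
    IsConvexHypersurface X where
  posDef : ∀ x, (secondForm X x).PosDef

/-- The inner radius of a convex body: the supremum of the radii of the balls it contains. -/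
def innerRadius {n : ℕ} (Ω : Set (Amb n)) : ℝ :=
  sSup {r : ℝ | 0 ≤ r ∧ ∃ c, closedBall c r ⊆ Ω}

/-- The standing assumptions on the speed function `f : (0, ∞) → (0, ∞)`. -/
structure SpeedCondition (n : ℕ) (f : ℝ → ℝ) : Prop where
  smooth : ContDiffOn ℝ ∞ f (Ioi 0)
  pos : ∀ K, 0 < K → 0 < f K
  deriv_pos : ∀ K, 0 < K → 0 < deriv f K
  homogeneity : ∃ α₁ α₂ : ℝ, 0 < α₁ ∧ α₁ < α₂ ∧ α₂ ≤ (n : ℝ) - 1 ∧ ∀ K, 0 < K →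
    α₁ ≤ ((n : ℝ) * K * deriv f K - f K) / f K ∧
      ((n : ℝ) * K * deriv f K - f K) / f K ≤ α₂
  second_order : ∃ β : ℝ, 0 < β ∧ ∀ K, 0 < K →
    0 < K * deriv (deriv f) K / deriv f K + 1 - 1 / (n : ℝ) ∧
      K * deriv (deriv f) K / deriv f K + 1 - 1 / (n : ℝ) ≤ β
  growth : ∃ γ γ' : ℝ, 0 < γ ∧ 0 < γ' ∧ ∀ᶠ K in atTop, γ' ≤ K / f K ^ γ
  /-- `f(K)` is convex as a function of the principal radii `χ_1, …, χ_n > 0`, where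
  `K = 1 / (χ_1 ⋯ χ_n)`. -/
  convex_radii : ConvexOn ℝ {χ : Fin n → ℝ | ∀ i, 0 < χ i} fun χ => f (∏ i, χ i)⁻¹

/-- The time interval `[0, T)`, with `T ∈ (0, ∞]`. -/
def timeInterval (T : EReal) : Set ℝ := {t : ℝ | 0 ≤ t ∧ (t : EReal) < T}

/-- `F(·, t)`, `t ∈ [0, T)`, is a smooth family of convex hypersurfaces of positive Gauss
curvature (`f` is a function on `(0, ∞)`) that solves `∂F/∂t = -f(K) v`, `F(·, 0) = X₀`. -/
structure IsFlow {n : ℕ} (f : ℝ → ℝ) (X₀ : Sph n → Amb n) (T : EReal)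
    (F : ℝ → Sph n → Amb n) : Prop where
  smooth : ContMDiffOn ((𝓡 n).prod 𝓘(ℝ, ℝ)) 𝓘(ℝ, Amb n) ∞
    (fun p : Sph n × ℝ => F p.2 p.1) (univ ×ˢ timeInterval T)
  convex : ∀ t ∈ timeInterval T, IsConvexHypersurface (F t)
  curvature_pos : ∀ t ∈ timeInterval T, ∀ x, 0 < gaussCurvature (F t) x
  initial : F 0 = X₀
  evolution : ∀ t ∈ timeInterval T, ∀ x,
    HasDerivWithinAt (fun s => F s x)
      (-(f (gaussCurvature (F t) x) • outerNormal (F t) x)) (timeInterval T) t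

end GaussFlow

end

/-! This is Tso's speed estimate, obtained by a two-point maximum principle in time instead of an
evolution equation for the speed. Let the body at time t₁ contain the ball of radius 2δ about c. The
bodies shrink (`IsFlow.antitoneOn_supportFn`), so with s the support function, S(z, t) = s(z, t) -
⟪c, z⟫ - δ is at least δ on all of [0, t₁]. In a fixed direction z, s formally decreases at rate
f(K), so the bound f(K) ≤ L S amounts to S e^{Lt} being nondecreasing in t. That monotonicity is
`IsFlow.weightedSupport_mono`.

Suppose it fails, and maximize the ratio of the values of S e^{Lt} at times a ≤ b over all z, a, b.
The maximum exceeds 1 and is attained with a < b; L is so large that a > 0. Let ρ = S(z, a) / S(z,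
b) > 1 and let κ_a, κ_b be the n-th roots of the curvatures at normal z. Optimality in time gives
f(K_a) ≤ L S(z, a) and f(K_b) ≥ L S(z, b), hence f(K_a) ≤ ρ f(K_b). Optimality in direction says
that, relative to c, s_a ≤ ρ s_b - (ρ - 1)δ on unit vectors, with equality at z.

Comparing second order terms at z (`touching_comparison`) gives A_a ≤ ρ A_b - (ρ - 1)δ for the
inverse Weingarten maps, whose determinants are 1/K. By the arithmetic-geometric mean inequality
(`det_comparison`), κ_b/κ_a ≤ ρ - (ρ - 1)δκ_b, which is at most 2 - ρ once δκ_b ≥ 2; large L ensures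
this because f(K_b) ≥ Lδ. But κ ↦ f(κⁿ)/κ is nondecreasing (`SpeedCondition.mul_le_mul`), so κ_a ≤
ρκ_b, and ρ(2 - ρ) < 1 is a contradiction (`SpeedCondition.not_comparison`).

The constant L depends on f, n, r₀ and the maximal initial curvature (`exists_gaussCurvature_le`),
not on t₁. The initial hypersurface bounds S from above, and the growth f(κⁿ) ≥ κ f(1) for κ ≥ 1
turns the speed bound into a curvature bound. -/

noncomputable section

namespace GaussFlow

/-! ### Trace and determinant inequalities for quadratic forms. -/

section LinearAlgebra

open Matrix

/-- The arithmetic-geometric mean inequality for the eigenvalues of a matrix. -/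
theorem det_le_trace_div_pow {n : ℕ} (hn : 0 < n) {P : Matrix (Fin n) (Fin n) ℝ}
    (hP : P.PosSemidef) : P.det ≤ (P.trace / n) ^ n := by
  have hn' : (0 : ℝ) < n := by exact_mod_cast hn
  have h0 : ∀ i, 0 ≤ hP.1.eigenvalues i := hP.eigenvalues_nonneg
  rw [hP.1.det_eq_prod_eigenvalues, hP.1.trace_eq_sum_eigenvalues]
  have h := Real.geom_mean_le_arith_mean Finset.univ (fun _ : Fin n => (1 : ℝ))
    hP.1.eigenvalues (fun _ _ => zero_le_one) (by simpa using hn) (fun i _ => h0 i)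
  simp only [Real.rpow_one, Finset.sum_const, Finset.card_univ, Fintype.card_fin, nsmul_eq_mul,
    mul_one, one_mul] at h
  have hp : 0 ≤ ∏ i, hP.1.eigenvalues i := Finset.prod_nonneg fun i _ => h0 i
  calc ∏ i, ((hP.1.eigenvalues i : ℝ))
      = ((∏ i, hP.1.eigenvalues i) ^ ((n : ℝ)⁻¹)) ^ n := by
        rw [Real.rpow_inv_natCast_pow hp hn.ne']
    _ ≤ _ := pow_le_pow_left₀ (by positivity) h n

theorem exists_transpose_mul_self {n : ℕ} {P : Matrix (Fin n) (Fin n) ℝ} (hP : P.PosSemidef) :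
    ∃ M : Matrix (Fin n) (Fin n) ℝ, P = Mᵀ * M := by
  open scoped MatrixOrder in
  obtain ⟨M, hM⟩ := CStarAlgebra.nonneg_iff_eq_star_mul_self.1 (Matrix.nonneg_iff_posSemidef.2 hP)
  exact ⟨M, by rw [hM, star_eq_conjTranspose, conjTranspose_eq_transpose_of_trivial]⟩

theorem trace_inv_mul_nonneg {n : ℕ} {P Z : Matrix (Fin n) (Fin n) ℝ}
    (hP : P.PosDef) (hZ : Z.PosSemidef) : 0 ≤ (P⁻¹ * Z).trace := by
  obtain ⟨M, hM⟩ := exists_transpose_mul_self hP.inv.posSemidef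
  have h := (hZ.mul_mul_conjTranspose_same M).trace_nonneg
  rwa [conjTranspose_eq_transpose_of_trivial, trace_mul_cycle, ← hM] at h

/-- The product P⁻¹Z need not be symmetric, but writing P⁻¹ = MᵀM replaces it by the positive
semidefinite M Z Mᵀ, which has the same trace and determinant. -/
theorem det_inv_mul_le_trace_div_pow {n : ℕ} (hn : 0 < n) {P Z : Matrix (Fin n) (Fin n) ℝ}
    (hP : P.PosDef) (hZ : Z.PosSemidef) :
    P.det⁻¹ * Z.det ≤ ((P⁻¹ * Z).trace / n) ^ n := by
  obtain ⟨M, hM⟩ := exists_transpose_mul_self hP.inv.posSemidef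
  have h := det_le_trace_div_pow hn (hZ.mul_mul_conjTranspose_same M)
  rw [conjTranspose_eq_transpose_of_trivial, trace_mul_cycle, ← hM] at h
  refine le_of_eq_of_le ?_ h
  rw [← Ring.inverse_eq_inv', ← det_nonsing_inv, hM]
  simp only [det_mul, det_transpose]
  ring

/-- If `A₁ ≤ ρ A₀ - μ` as quadratic forms, then the determinants satisfy
`(det A₁ / det A₀)^{1/n} ≤ ρ - μ (det A₀)^{-1/n}`. -/
theorem det_comparison {n : ℕ} (hn : 0 < n) {A₀ A₁ : Matrix (Fin n) (Fin n) ℝ}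
    (h₀ : A₀.PosDef) (h₁ : A₁.PosDef) {ρ μ κ : ℝ} (hμ : 0 ≤ μ)
    (hκ : κ ^ n * A₀.det = 1)
    (h : ∀ c : Fin n → ℝ, c ⬝ᵥ A₁ *ᵥ c ≤ ρ * (c ⬝ᵥ A₀ *ᵥ c) - μ * (c ⬝ᵥ c)) :
    κ ^ n * A₁.det ≤ (ρ - μ * κ) ^ n ∧ 0 ≤ ρ - μ * κ := by
  have hn' : (0 : ℝ) < n := by exact_mod_cast hn
  have hdet := h₀.det_pos
  have hκ' : κ ^ n = A₀.det⁻¹ := eq_inv_of_mul_eq_one_left hκ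
  have hZ : (ρ • A₀ - μ • 1 - A₁).PosSemidef := by
    refine .of_dotProduct_mulVec_nonneg ?_ fun c => ?_
    · exact ((h₀.isHermitian.smul (IsSelfAdjoint.all ρ)).sub
        (isHermitian_one.smul (IsSelfAdjoint.all μ))).sub h₁.isHermitian
    · have := h c
      simp only [star_trivial, sub_mulVec, smul_mulVec, one_mulVec, dotProduct_sub,
        dotProduct_smul, smul_eq_mul]
      linarith
  have ht := trace_inv_mul_nonneg h₀ hZ
  have hA : A₀⁻¹ * A₀ = 1 := nonsing_inv_mul _ hdet.ne'.isUnit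
  simp only [mul_sub, mul_smul_comm, hA, trace_sub, trace_smul, trace_one, mul_one, smul_eq_mul,
    Fintype.card_fin] at ht
  -- The arithmetic-geometric mean inequality for A₀⁻¹ itself; it turns the trace of the term μ A₀⁻¹
  -- into the desired μκ.
  have hκt : κ ≤ A₀⁻¹.trace / n := by
    have h1 := det_inv_mul_le_trace_div_pow hn h₀ (Z := 1) PosSemidef.one
    rw [det_one, mul_one, mul_one, ← hκ'] at h1
    exact le_of_pow_le_pow_left₀ hn.ne'
      (div_nonneg h₀.inv.posSemidef.trace_nonneg hn'.le) h1
  have h2 := det_inv_mul_le_trace_div_pow hn h₀ h₁.posSemidef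
  have h3 := trace_inv_mul_nonneg h₀ h₁.posSemidef
  have h4 : (A₀⁻¹ * A₁).trace / n ≤ ρ - μ * κ := by
    rw [div_le_iff₀ hn']
    have := mul_le_mul_of_nonneg_left ((le_div_iff₀ hn').1 hκt) hμ
    nlinarith
  have h5 : 0 ≤ (A₀⁻¹ * A₁).trace / n := div_nonneg h3 hn'.le
  exact ⟨hκ' ▸ h2.trans (pow_le_pow_left₀ h5 h4 n), h5.trans h4⟩

theorem det_div_le_of_quadratic_le {n : ℕ} (hn : 0 < n) {G H : Matrix (Fin n) (Fin n) ℝ}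
    (hG : G.PosDef) (hH : H.PosSemidef) {Λ : ℝ}
    (h : ∀ c : Fin n → ℝ, c ⬝ᵥ H *ᵥ c ≤ Λ * (c ⬝ᵥ G *ᵥ c)) :
    H.det / G.det ≤ Λ ^ n := by
  have hn' : (0 : ℝ) < n := by exact_mod_cast hn
  have hZ : (Λ • G - H).PosSemidef := by
    refine .of_dotProduct_mulVec_nonneg
      ((hG.isHermitian.smul (IsSelfAdjoint.all Λ)).sub hH.isHermitian) fun c => ?_
    have := h c
    simp only [star_trivial, sub_mulVec, smul_mulVec, dotProduct_sub, dotProduct_smul, smul_eq_mul]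
    linarith
  have ht := trace_inv_mul_nonneg hG hZ
  have hA : G⁻¹ * G = 1 := nonsing_inv_mul _ hG.det_pos.ne'.isUnit
  simp only [mul_sub, mul_smul_comm, hA, trace_sub, trace_smul, trace_one, smul_eq_mul,
    Fintype.card_fin] at ht
  rw [div_eq_inv_mul]
  refine (det_inv_mul_le_trace_div_pow hn hG hH).trans (pow_le_pow_left₀
    (div_nonneg (trace_inv_mul_nonneg hG hH) hn'.le) ?_ n)
  rw [div_le_iff₀ hn']
  linarith

/-- Comparison of the Gauss curvatures of two hypersurfaces with a common normal `z`, given in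
terms of their tangent vectors `e`, `d` and second fundamental forms `h`, `k`. -/
theorem curvature_comparison {n : ℕ} (hn : 0 < n) {z : Amb n} (hz : ‖z‖ = 1) {e d : Fin n → Amb n}
    (he : LinearIndependent ℝ e) (hd : LinearIndependent ℝ d)
    (hez : ∀ i, ⟪e i, z⟫ = 0) (hdz : ∀ i, ⟪d i, z⟫ = 0)
    {h k : Matrix (Fin n) (Fin n) ℝ} (hh : h.PosDef) (hk : k.PosDef) {ρ μ κ : ℝ} (hμ : 0 ≤ μ)
    (hκ : κ ^ n = h.det / (gram ℝ e).det)
    (H : ∀ (w : Fin n → ℝ) (a : Amb n), ⟪a, z⟫ = 0 →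
      2 * ⟪∑ i, w i • d i, a⟫ - w ⬝ᵥ k *ᵥ w ≤
        ρ * ((fun i => ⟪e i, a⟫) ⬝ᵥ h⁻¹ *ᵥ (fun i => ⟪e i, a⟫)) - μ * ‖a‖ ^ 2) :
    κ ^ n / (k.det / (gram ℝ d).det) ≤ (ρ - μ * κ) ^ n ∧ 0 ≤ ρ - μ * κ := by
  have hz0 : z ≠ 0 := norm_ne_zero_iff.1 (by rw [hz]; exact one_ne_zero)
  have hfin : Module.finrank ℝ (ℝ ∙ z)ᗮ = n :=
    haveI : Fact (Module.finrank ℝ (Amb n) = n + 1) := ⟨by simp⟩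
    Submodule.finrank_orthogonal_span_singleton hz0
  let o : OrthonormalBasis (Fin n) ℝ (ℝ ∙ z)ᗮ := (stdOrthonormalBasis ℝ _).reindex (finCongr hfin)
  have gram_eq : ∀ {e : Fin n → Amb n}, (∀ i, ⟪e i, z⟫ = 0) →
      gram ℝ e = (of fun a i => ⟪(o a : Amb n), e i⟫)ᵀ * of fun a i => ⟪(o a : Amb n), e i⟫ := by
    intro e he
    have hm : ∀ i, e i ∈ (ℝ ∙ z)ᗮ := fun i =>
      Submodule.mem_orthogonal_singleton_iff_inner_left.2 (he i)
    have := gram_eq_conjTranspose_mul o fun i => (⟨e i, hm i⟩ : (ℝ ∙ z)ᗮ)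
    rw [conjTranspose_eq_transpose_of_trivial] at this
    convert this using 3 <;> (ext a i; simp [OrthonormalBasis.repr_apply_apply])
  set E : Matrix (Fin n) (Fin n) ℝ := of fun a i => ⟪(o a : Amb n), e i⟫ with hE
  set D : Matrix (Fin n) (Fin n) ℝ := of fun a i => ⟪(o a : Amb n), d i⟫ with hD
  have hgE : (gram ℝ e).det = E.det * E.det := by rw [gram_eq hez, det_mul, det_transpose]
  have hgD : (gram ℝ d).det = D.det * D.det := by rw [gram_eq hdz, det_mul, det_transpose]
  have hE0 : E.det ≠ 0 := fun h0 =>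
    (posDef_gram_of_linearIndependent he).det_pos.ne' (by rw [hgE, h0, zero_mul])
  have hD0 : D.det ≠ 0 := fun h0 =>
    (posDef_gram_of_linearIndependent hd).det_pos.ne' (by rw [hgD, h0, zero_mul])
  -- E h⁻¹ Eᵀ is the inverse Weingarten map in the orthonormal basis `o` of the common tangent
  -- space; its determinant is det g / det h = 1/K.
  have conj : ∀ {E h : Matrix (Fin n) (Fin n) ℝ}, E.det ≠ 0 → h.PosDef →
      (E * h⁻¹ * Eᵀ).PosDef := by
    intro E h hE hh
    rw [← conjTranspose_eq_transpose_of_trivial]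
    refine hh.inv.mul_mul_conjTranspose_same ?_
    exact vecMul_injective_iff_isUnit.2 ((isUnit_iff_isUnit_det _).2 hE.isUnit)
  have hdet : ∀ E h : Matrix (Fin n) (Fin n) ℝ, (E * h⁻¹ * Eᵀ).det = E.det * E.det / h.det := by
    intro E h
    rw [det_mul, det_mul, det_transpose, det_nonsing_inv, Ring.inverse_eq_inv']
    ring
  have hkd := hk.det_pos
  have hhd := hh.det_pos
  have main := det_comparison hn (conj hE0 hh) (conj hD0 hk) (ρ := ρ) hμ (κ := κ)
    (by rw [hdet, hκ, hgE]; field_simp) ?_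
  · refine ⟨le_of_eq_of_le ?_ main.1, main.2⟩
    rw [hdet, hgD]
    field_simp
  intro c
  have quad : ∀ E h : Matrix (Fin n) (Fin n) ℝ,
      c ⬝ᵥ (E * h⁻¹ * Eᵀ) *ᵥ c = (Eᵀ *ᵥ c) ⬝ᵥ h⁻¹ *ᵥ (Eᵀ *ᵥ c) := by
    intro E h
    rw [← mulVec_mulVec, ← mulVec_mulVec, dotProduct_mulVec, mulVec_transpose]
  rw [quad, quad]
  set a : Amb n := ∑ i, c i • (o i : Amb n) with ha
  have haz : ⟪a, z⟫ = 0 := by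
    rw [ha, sum_inner]
    refine Finset.sum_eq_zero fun i _ => ?_
    rw [inner_smul_left, Submodule.mem_orthogonal_singleton_iff_inner_left.1 (o i).2, mul_zero]
  have hb : ∀ e : Fin n → Amb n, (fun i => ⟪e i, a⟫) =
      (of fun a i => ⟪(o a : Amb n), e i⟫)ᵀ *ᵥ c := by
    intro e
    ext i
    simp only [ha, inner_sum, inner_smul_right, mulVec, dotProduct, transpose_apply, of_apply]
    exact Finset.sum_congr rfl fun j _ => by rw [real_inner_comm, mul_comm]
  have hn2 : ‖a‖ ^ 2 = c ⬝ᵥ c := by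
    have : a = ((∑ i, c i • o i : (ℝ ∙ z)ᗮ) : Amb n) := by simp [ha]
    rw [this, ← real_inner_self_eq_norm_sq, ← Submodule.coe_inner, sum_inner]
    refine Finset.sum_congr rfl fun i _ => ?_
    rw [inner_smul_left, o.orthonormal.inner_right_fintype]
    simp
  -- This w maximizes the left side of `H`; the maximum is the quadratic form of D k⁻¹ Dᵀ at c, the
  -- Legendre dual of k.
  have hw := H (k⁻¹ *ᵥ (Dᵀ *ᵥ c)) a haz
  have hs : ⟪∑ i, (k⁻¹ *ᵥ (Dᵀ *ᵥ c)) i • d i, a⟫ = (Dᵀ *ᵥ c) ⬝ᵥ k⁻¹ *ᵥ (Dᵀ *ᵥ c) := by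
    rw [sum_inner, dotProduct_comm]
    refine Finset.sum_congr rfl fun i _ => ?_
    rw [inner_smul_left, ← hb d]
    simp
  have hkk : k *ᵥ (k⁻¹ *ᵥ (Dᵀ *ᵥ c)) = Dᵀ *ᵥ c := by
    rw [mulVec_mulVec, mul_nonsing_inv _ hkd.ne'.isUnit, one_mulVec]
  rw [hs, hkk, dotProduct_comm (k⁻¹ *ᵥ _), hb e, hn2] at hw
  linarith

/-- Young's inequality for a positive definite quadratic form. -/
theorem dotProduct_le_young {n : ℕ} {h : Matrix (Fin n) (Fin n) ℝ} (hh : h.PosDef)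
    {l : ℝ} (hl : 0 < l) (b w : Fin n → ℝ) (s : ℝ) :
    s * (w ⬝ᵥ b) ≤ l / 2 * (w ⬝ᵥ h *ᵥ w) + s ^ 2 / (2 * l) * (b ⬝ᵥ h⁻¹ *ᵥ b) := by
  have h1 := hh.posSemidef.dotProduct_mulVec_nonneg (l • w - s • (h⁻¹ *ᵥ b))
  have h2 : h *ᵥ (h⁻¹ *ᵥ b) = b := by
    rw [mulVec_mulVec, mul_nonsing_inv _ hh.det_pos.ne'.isUnit, one_mulVec]
  have h3 : (h⁻¹ *ᵥ b) ⬝ᵥ h *ᵥ w = w ⬝ᵥ b := by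
    rw [dotProduct_mulVec, ← mulVec_transpose,
      (conjTranspose_eq_transpose_of_trivial h).symm.trans hh.isHermitian, h2, dotProduct_comm]
  simp only [star_trivial, mulVec_sub, mulVec_smul, h2, dotProduct_sub, sub_dotProduct,
    smul_dotProduct, dotProduct_smul, h3, smul_eq_mul] at h1
  rw [dotProduct_comm (h⁻¹ *ᵥ b) b] at h1
  have h4 : l / 2 * (w ⬝ᵥ h *ᵥ w) + s ^ 2 / (2 * l) * (b ⬝ᵥ h⁻¹ *ᵥ b) - s * (w ⬝ᵥ b) =
      (l * (l * (w ⬝ᵥ h *ᵥ w) - s * (w ⬝ᵥ b)) -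
        s * (l * (w ⬝ᵥ b) - s * (b ⬝ᵥ h⁻¹ *ᵥ b))) / (2 * l) := by
    field_simp
    ring
  have h5 := div_nonneg h1 (by positivity : 0 ≤ 2 * l)
  linarith

end LinearAlgebra

/-! ### Second order Taylor expansion. -/

section Taylor

variable {E V : Type*} [NormedAddCommGroup E] [NormedSpace ℝ E]
  [NormedAddCommGroup V] [NormedSpace ℝ V]

/-- Taylor's formula of order two with Peano remainder. -/
theorem taylor_two {φ : E → V} (hφ : ContDiff ℝ ∞ φ) (u : E) {η : ℝ} (hη : 0 < η) :
    ∀ᶠ w in 𝓝 (0 : E), ‖φ (u + w) - φ u - fderiv ℝ φ u w -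
      (1 / 2 : ℝ) • fderiv ℝ (fderiv ℝ φ) u w w‖ ≤ η * ‖w‖ ^ 2 := by
  have hd : Differentiable ℝ φ := hφ.differentiable (by simp)
  have hd2 : Differentiable ℝ (fderiv ℝ φ) :=
    (hφ.fderiv_right (m := ∞) (by simp)).differentiable (by simp)
  have hsymm : IsSymmSndFDerivAt ℝ φ u := hφ.contDiffAt.isSymmSndFDerivAt
    (minSmoothness_of_isRCLikeNormedField (𝕜 := ℝ) ▸ WithTop.coe_le_coe.2 le_top)
  set B := fderiv ℝ (fderiv ℝ φ) u with hB
  have h1 : HasFDerivAt (fderiv ℝ φ) B u := (hd2 u).hasFDerivAt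
  have h2 := (hasFDerivAt_iff_isLittleO_nhds_zero.1 h1).def hη
  obtain ⟨r, hr, hball⟩ := Metric.eventually_nhds_iff_ball.1 h2
  refine Metric.eventually_nhds_iff_ball.2 ⟨r, hr, fun w hw => ?_⟩
  set g : E → V := fun w => φ (u + w) - φ u - fderiv ℝ φ u w - (1 / 2 : ℝ) • B w w with hg
  have hgd : ∀ x, HasFDerivAt g (fderiv ℝ φ (u + x) - fderiv ℝ φ u - B x) x := by
    intro x
    have e1 : HasFDerivAt (fun w => φ (u + w)) (fderiv ℝ φ (u + x)) x := by
      exact (hd (u + x)).hasFDerivAt.comp x ((hasFDerivAt_id x).const_add u)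
    have e2 : HasFDerivAt (fun w => B w w) ((B x) + B.flip x) x := by
      have := (B.hasFDerivAt (x := x)).clm_apply (hasFDerivAt_id x)
      simpa using this
    have e3 := ((e1.sub_const (φ u)).sub (fderiv ℝ φ u).hasFDerivAt).sub
      (e2.const_smul (1 / 2 : ℝ))
    refine e3.congr_fderiv ?_
    ext v
    have : B v x = B x v := hsymm v x
    rw [sub_apply, sub_apply, sub_apply, sub_apply, smul_apply, add_apply,
      ContinuousLinearMap.flip_apply, this]
    rw [← two_smul ℝ, smul_smul]
    norm_num
  have hs : Convex ℝ (closedBall (0 : E) ‖w‖) := convex_closedBall _ _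
  have hb : ∀ x ∈ closedBall (0 : E) ‖w‖,
      ‖fderiv ℝ φ (u + x) - fderiv ℝ φ u - B x‖ ≤ η * ‖w‖ := by
    intro x hx
    have hx' : ‖x‖ ≤ ‖w‖ := by simpa using hx
    have hw' : ‖w‖ < r := by simpa using hw
    exact (hball x (by simpa using hx'.trans_lt hw')).trans (by gcongr)
  have := hs.norm_image_sub_le_of_norm_hasFDerivWithin_le
    (fun x _ => (hgd x).hasFDerivWithinAt) hb (x := 0) (y := w) (by simp) (by simp)
  simp only [hg, add_zero, sub_self, map_zero, smul_zero, sub_zero] at this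
  calc _ ≤ _ := this
    _ = η * ‖w‖ ^ 2 := by ring

/-- The second derivative as a limit of difference quotients, so that inequalities between heights
pass to the second fundamental form. -/
theorem taylor_two_ray {φ : E → V} (hφ : ContDiff ℝ ∞ φ) (u w : E) :
    Tendsto (fun t : ℝ => (t ^ 2)⁻¹ • (φ (u + t • w) - φ u - t • fderiv ℝ φ u w)) (𝓝[≠] 0)
      (𝓝 ((1 / 2 : ℝ) • fderiv ℝ (fderiv ℝ φ) u w w)) := by
  rw [Metric.tendsto_nhds]
  intro ε hε
  have hη : 0 < ε / (2 * (‖w‖ ^ 2 + 1)) := by positivity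
  have ht : Tendsto (fun t : ℝ => t • w) (𝓝[≠] 0) (𝓝 0) := by
    have : Continuous fun t : ℝ => t • w := by fun_prop
    exact (this.tendsto' 0 0 (by simp)).mono_left nhdsWithin_le_nhds
  filter_upwards [ht.eventually (taylor_two hφ u hη), self_mem_nhdsWithin] with t h1 h2
  have ht0 : t ≠ 0 := h2
  have h3 : (t ^ 2)⁻¹ • (φ (u + t • w) - φ u - t • fderiv ℝ φ u w) -
      (1 / 2 : ℝ) • fderiv ℝ (fderiv ℝ φ) u w w = (t ^ 2)⁻¹ • (φ (u + t • w) - φ u -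
        fderiv ℝ φ u (t • w) - (1 / 2 : ℝ) • fderiv ℝ (fderiv ℝ φ) u (t • w) (t • w)) := by
    simp only [map_smul, smul_apply, smul_sub, smul_smul]
    field_simp
  rw [dist_eq_norm, h3, norm_smul, norm_inv, Real.norm_of_nonneg (sq_nonneg t),
    inv_mul_lt_iff₀ (by positivity)]
  refine h1.trans_lt ?_
  rw [norm_smul, mul_pow, Real.norm_eq_abs, sq_abs]
  have hlt : ε / (2 * (‖w‖ ^ 2 + 1)) * ‖w‖ ^ 2 < ε := by
    rw [div_mul_eq_mul_div, div_lt_iff₀ (by positivity)]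
    nlinarith [sq_nonneg ‖w‖]
  have : 0 < t ^ 2 := by positivity
  nlinarith

end Taylor

/-! ### Normals and fundamental forms of a convex hypersurface in charts. -/

section Hypersurface

variable {n : ℕ} {X : Sph n → Amb n}

theorem localRep_contDiff (hX : ContMDiff (𝓡 n) 𝓘(ℝ, Amb n) ∞ X) (x : Sph n) :
    ContDiff ℝ ∞ (localRep X x) := by
  have h1 := contMDiffOn_extChartAt_symm (I := 𝓡 n) (n := ∞) x
  have ht : (extChartAt (𝓡 n) x).target = univ := by
    simp [chartAt, ChartedSpace.chartAt]
  rw [ht, contMDiffOn_univ] at h1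
  exact (hX.comp h1).contDiff

theorem localRep_self (X : Sph n → Amb n) (x : Sph n) :
    localRep X x (extChartAt (𝓡 n) x x) = X x := by
  simp [localRep]

theorem eventually_exists_chart (x : Sph n) {U : Set (EuclideanSpace ℝ (Fin n))}
    (hU : U ∈ 𝓝 (extChartAt (𝓡 n) x x)) :
    ∀ᶠ y in 𝓝 x, ∃ u ∈ U, (extChartAt (𝓡 n) x).symm u = y := by
  filter_upwards [(continuousAt_extChartAt (I := 𝓡 n) x).eventually hU,
    extChartAt_source_mem_nhds (I := 𝓡 n) x] with y h1 h2
  exact ⟨_, h1, (extChartAt (𝓡 n) x).left_inv h2⟩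

/-- The differential of a parametrization in the chart around `x`. -/
def tangentMap (X : Sph n → Amb n) (x : Sph n) : EuclideanSpace ℝ (Fin n) →L[ℝ] Amb n :=
  fderiv ℝ (localRep X x) (extChartAt (𝓡 n) x x)

/-- The second derivative of a parametrization in the chart around `x`. -/
def hessianMap (X : Sph n → Amb n) (x : Sph n) :
    EuclideanSpace ℝ (Fin n) →L[ℝ] EuclideanSpace ℝ (Fin n) →L[ℝ] Amb n :=
  fderiv ℝ (fderiv ℝ (localRep X x)) (extChartAt (𝓡 n) x x)

theorem coordD2_eq (hX : ContMDiff (𝓡 n) 𝓘(ℝ, Amb n) ∞ X) (x : Sph n) (i j : Fin n) :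
    coordD2 X x i j =
      hessianMap X x (EuclideanSpace.single i 1) (EuclideanSpace.single j 1) := by
  have hd2 : Differentiable ℝ (fderiv ℝ (localRep X x)) :=
    ((localRep_contDiff hX x).fderiv_right (m := ∞) (by simp)).differentiable (by simp)
  have := (hd2 (extChartAt (𝓡 n) x x)).hasFDerivAt.clm_apply
    (hasFDerivAt_const (EuclideanSpace.single j (1 : ℝ)) _)
  unfold coordD2 partialD
  rw [this.fderiv]
  simp [hessianMap]

theorem sum_single (w : EuclideanSpace ℝ (Fin n)) :
    w = ∑ i, w i • EuclideanSpace.single i (1 : ℝ) := by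
  ext j
  simp [Finset.sum_apply, Pi.single_apply]

theorem tangentMap_apply (X : Sph n → Amb n) (x : Sph n) (w : EuclideanSpace ℝ (Fin n)) :
    tangentMap X x w = ∑ i, w i • coordD X x i := by
  conv_lhs => rw [sum_single w, map_sum]
  exact Finset.sum_congr rfl fun i _ => map_smul _ _ _

theorem tangentMap_injective (hX : IsConvexHypersurface X) (x : Sph n) :
    Function.Injective (tangentMap X x) := by
  rw [injective_iff_map_eq_zero]
  intro w hw
  rw [tangentMap_apply] at hw
  ext i
  exact Fintype.linearIndependent_iff.1 (hX.immersion x) _ hw i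

theorem dotProduct_secondForm (hX : ContMDiff (𝓡 n) 𝓘(ℝ, Amb n) ∞ X) (x : Sph n)
    (w : EuclideanSpace ℝ (Fin n)) :
    w.ofLp ⬝ᵥ (secondForm X x).mulVec w.ofLp = -⟪hessianMap X x w w, outerNormal X x⟫ := by
  conv_rhs => rw [sum_single w]
  simp only [map_sum, map_smul, sum_apply, smul_apply,
    sum_inner, inner_smul_left, ← coordD2_eq hX, dotProduct, Matrix.mulVec, secondForm,
    Matrix.of_apply, Finset.mul_sum, Finset.smul_sum, ← Finset.sum_neg_distrib]
  rw [Finset.sum_comm]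
  refine Finset.sum_congr rfl fun i _ => Finset.sum_congr rfl fun j _ => ?_
  simp
  ring

theorem metricMatrix_eq_gram (X : Sph n → Amb n) (x : Sph n) :
    metricMatrix X x = Matrix.gram ℝ (coordD X x) := rfl

theorem dotProduct_metricMatrix (X : Sph n → Amb n) (x : Sph n)
    (w : EuclideanSpace ℝ (Fin n)) :
    w.ofLp ⬝ᵥ (metricMatrix X x).mulVec w.ofLp = ‖tangentMap X x w‖ ^ 2 := by
  have := Matrix.star_dotProduct_gram_mulVec (𝕜 := ℝ) (coordD X x) w.ofLp w.ofLp
  rw [star_trivial] at this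
  rw [metricMatrix_eq_gram, this, tangentMap_apply, real_inner_self_eq_norm_sq]

theorem metricMatrix_posDef (hX : IsConvexHypersurface X) (x : Sph n) :
    (metricMatrix X x).PosDef :=
  Matrix.posDef_gram_of_linearIndependent (hX.immersion x)

/-- First order condition at a maximum of the height in direction z. The point u of the chart is
arbitrary, so that one chart serves all points near x. -/
theorem inner_fderiv_localRep_eq_zero (hX : ContMDiff (𝓡 n) 𝓘(ℝ, Amb n) ∞ X) {x : Sph n}
    {u : EuclideanSpace ℝ (Fin n)} {z : Amb n}
    (h : ∀ y, ⟪X y - localRep X x u, z⟫ ≤ 0) (w : EuclideanSpace ℝ (Fin n)) :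
    ⟪fderiv ℝ (localRep X x) u w, z⟫ = 0 := by
  have hd : HasFDerivAt (localRep X x) (fderiv ℝ (localRep X x) u) u :=
    ((localRep_contDiff hX x).differentiable (by simp) u).hasFDerivAt
  have hm : IsLocalMax (fun y => ⟪localRep X x y, z⟫) u := by
    refine Eventually.of_forall fun y => ?_
    have := h ((extChartAt (𝓡 n) x).symm y)
    rw [inner_sub_left] at this
    exact sub_nonpos.1 this
  have h1 := hm.hasFDerivAt_eq_zero (hd.inner ℝ (hasFDerivAt_const z u))
  have h2 := DFunLike.congr_fun h1 w
  simpa using h2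

theorem inner_tangentMap_eq_zero (hX : ContMDiff (𝓡 n) 𝓘(ℝ, Amb n) ∞ X) {x : Sph n} {z : Amb n}
    (h : ∀ y, ⟪X y - X x, z⟫ ≤ 0) (w : EuclideanSpace ℝ (Fin n)) : ⟪tangentMap X x w, z⟫ = 0 :=
  inner_fderiv_localRep_eq_zero hX (by rwa [localRep_self]) w

theorem isOuterUnitNormal_of_le (hX : ContMDiff (𝓡 n) 𝓘(ℝ, Amb n) ∞ X) {x : Sph n} {z : Amb n}
    (hz : ‖z‖ = 1) (h : ∀ y, ⟪X y - X x, z⟫ ≤ 0) : IsOuterUnitNormal X x z :=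
  ⟨hz, fun i => inner_tangentMap_eq_zero hX h (EuclideanSpace.single i 1), h⟩

theorem enclosedBody_convex (X : Sph n → Amb n) : Convex ℝ (enclosedBody X) :=
  convex_convexHull ℝ _

theorem mem_enclosedBody (X : Sph n → Amb n) (x : Sph n) : X x ∈ enclosedBody X :=
  subset_convexHull ℝ _ (mem_range_self x)

theorem inner_le_of_mem_enclosedBody {z : Amb n} {c : ℝ} (h : ∀ y, ⟪X y, z⟫ ≤ c) {p : Amb n}
    (hp : p ∈ enclosedBody X) : ⟪p, z⟫ ≤ c := by
  have : enclosedBody X ⊆ {p | ⟪p, z⟫ ≤ c} := by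
    refine convexHull_min (range_subset_iff.2 h) ?_
    refine convex_halfSpace_le ⟨fun a b => inner_add_left _ _ _, fun a b => ?_⟩ c
    rw [inner_smul_left]; rfl
  exact this hp

theorem exists_isOuterUnitNormal (hX : IsConvexHypersurface X) (x : Sph n) :
    ∃ z, IsOuterUnitNormal X x z := by
  have hx : X x ∉ interior (enclosedBody X) := by
    have : X x ∈ frontier (enclosedBody X) := hX.range_eq ▸ mem_range_self x
    exact this.2
  obtain ⟨ℓ, hℓ⟩ := geometric_hahn_banach_open_point (enclosedBody_convex X).interior
    isOpen_interior hx
  set a := (InnerProductSpace.toDual ℝ (Amb n)).symm ℓ with ha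
  have haℓ : ∀ p, ℓ p = ⟪p, a⟫ := fun p => by
    rw [real_inner_comm, InnerProductSpace.toDual_symm_apply]
  have hle : ∀ p ∈ enclosedBody X, ⟪p, a⟫ ≤ ⟪X x, a⟫ := by
    intro p hp
    have hp' : p ∈ closure (interior (enclosedBody X)) := by
      rw [(enclosedBody_convex X).closure_interior_eq_closure_of_nonempty_interior
        hX.interior_nonempty]
      exact subset_closure hp
    refine closure_minimal (t := {p | ⟪p, a⟫ ≤ ⟪X x, a⟫}) (fun q hq => ?_)
      (isClosed_le (by fun_prop) continuous_const) hp'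
    have := (hℓ q hq).le
    rwa [haℓ, haℓ] at this
  have ha0 : a ≠ 0 := by
    obtain ⟨q, hq⟩ := hX.interior_nonempty
    intro h0
    have := hℓ q hq
    simp [haℓ, h0] at this
  refine ⟨‖a‖⁻¹ • a, isOuterUnitNormal_of_le hX.smooth ?_ fun y => ?_⟩
  · rw [norm_smul, norm_inv, norm_norm, inv_mul_cancel₀ (norm_ne_zero_iff.2 ha0)]
  · rw [inner_smul_right, inner_sub_left]
    exact mul_nonpos_of_nonneg_of_nonpos (by positivity)
      (sub_nonpos.2 (hle _ (mem_enclosedBody X y)))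

/-- The orthogonal complement of the n-dimensional tangent space is a line, so z' = ±z; opposite
normals would squeeze the body into a hyperplane, against its nonempty interior. -/
theorem IsOuterUnitNormal.unique (hX : IsConvexHypersurface X) {x : Sph n} {z z' : Amb n}
    (hz : IsOuterUnitNormal X x z) (hz' : IsOuterUnitNormal X x z') : z = z' := by
  set S := Submodule.span ℝ (range (coordD X x)) with hS
  have hmem : ∀ {z : Amb n}, IsOuterUnitNormal X x z → z ∈ Sᗮ := by
    intro z hz
    rw [Submodule.mem_orthogonal]
    intro u hu
    induction hu using Submodule.span_induction with
    | mem u hu => obtain ⟨i, rfl⟩ := hu; exact hz.2.1 i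
    | zero => simp
    | add a b _ _ ha hb => rw [inner_add_left, ha, hb, add_zero]
    | smul c a _ ha => rw [inner_smul_left, ha, mul_zero]
  have hfin : Module.finrank ℝ Sᗮ = 1 := by
    have h1 : Module.finrank ℝ S = n := by
      rw [hS, finrank_span_eq_card (hX.immersion x), Fintype.card_fin]
    have h2 := Submodule.finrank_add_finrank_orthogonal S
    rw [h1, finrank_euclideanSpace_fin] at h2
    omega
  have hz0 : (⟨z, hmem hz⟩ : Sᗮ) ≠ 0 := by
    intro h0
    have : z = 0 := congrArg Subtype.val h0
    have h1 := hz.1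
    rw [this, norm_zero] at h1
    exact zero_ne_one h1
  obtain ⟨c, hc⟩ := (finrank_eq_one_iff_of_nonzero' _ hz0).1 hfin ⟨z', hmem hz'⟩
  have hc' : c • z = z' := congrArg Subtype.val hc
  have habs : |c| = 1 := by
    have := hz'.1
    rwa [← hc', norm_smul, hz.1, mul_one, Real.norm_eq_abs] at this
  rcases eq_or_eq_neg_of_abs_eq habs with h | h
  · rw [← hc', h, one_smul]
  · exfalso
    obtain ⟨q, hq⟩ := hX.interior_nonempty
    obtain ⟨r, hr, hb⟩ := Metric.mem_nhds_iff.1 (mem_interior_iff_mem_nhds.1 hq)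
    have h1 : ∀ p ∈ enclosedBody X, ⟪p, z⟫ ≤ ⟪X x, z⟫ := fun p hp =>
      inner_le_of_mem_enclosedBody (fun y => by
        have := hz.2.2 y; rw [inner_sub_left] at this; linarith) hp
    have h2 : ∀ p ∈ enclosedBody X, ⟪p, z'⟫ ≤ ⟪X x, z'⟫ := fun p hp =>
      inner_le_of_mem_enclosedBody (fun y => by
        have := hz'.2.2 y; rw [inner_sub_left] at this; linarith) hp
    have hp : q + (r / 2) • z ∈ enclosedBody X := hb (by
      rw [mem_ball, dist_eq_norm, add_sub_cancel_left, norm_smul, hz.1, mul_one,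
        Real.norm_of_nonneg (by positivity)]
      linarith)
    have e1 := h1 _ hp
    have e2 := h2 q (hb (mem_ball_self hr))
    rw [← hc', h, neg_one_smul, inner_neg_right, inner_neg_right] at e2
    rw [inner_add_left, inner_smul_left, real_inner_self_eq_norm_sq, hz.1] at e1
    simp at e1
    linarith

theorem outerNormal_spec (hX : IsConvexHypersurface X) (x : Sph n) :
    IsOuterUnitNormal X x (outerNormal X x) :=
  Classical.epsilon_spec (exists_isOuterUnitNormal hX x)

theorem outerNormal_eq (hX : IsConvexHypersurface X) {x : Sph n} {z : Amb n}
    (hz : ‖z‖ = 1) (h : ∀ y, ⟪X y - X x, z⟫ ≤ 0) : outerNormal X x = z :=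
  (outerNormal_spec hX x).unique hX (isOuterUnitNormal_of_le hX.smooth hz h)

/-- The height in the normal direction is maximal at x and its differential vanishes there, so its
second order Taylor coefficient is nonpositive. -/
theorem secondForm_posSemidef (hX : IsConvexHypersurface X) (x : Sph n) :
    (secondForm X x).PosSemidef := by
  have hs : IsSymmSndFDerivAt ℝ (localRep X x) (extChartAt (𝓡 n) x x) :=
    (localRep_contDiff hX.smooth x).contDiffAt.isSymmSndFDerivAt
    (minSmoothness_of_isRCLikeNormedField (𝕜 := ℝ) ▸ WithTop.coe_le_coe.2 le_top)
  refine .of_dotProduct_mulVec_nonneg ?_ fun c => ?_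
  · ext i j
    simp only [secondForm, Matrix.conjTranspose_apply, Matrix.of_apply, star_trivial,
      coordD2_eq hX.smooth]
    rw [hessianMap, hs.eq]
  · have h := dotProduct_secondForm hX.smooth x (WithLp.toLp 2 c)
    rw [star_trivial]
    simp only at h
    rw [h]
    have ht := (taylor_two_ray (localRep_contDiff hX.smooth x) (extChartAt (𝓡 n) x x)
      (WithLp.toLp 2 c)).inner (𝕜 := ℝ) (tendsto_const_nhds (x := outerNormal X x))
    have h0 := le_of_tendsto ht (b := 0) (Eventually.of_forall fun t => by
      have h1 := (outerNormal_spec hX x).2.2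
      have h2 := inner_tangentMap_eq_zero hX.smooth h1 (WithLp.toLp 2 c)
      have h3 := h1 ((extChartAt (𝓡 n) x).symm (extChartAt (𝓡 n) x x + t • (WithLp.toLp 2 c)))
      rw [inner_smul_left, inner_sub_left, inner_smul_left,
        show ⟪fderiv ℝ (localRep X x) (extChartAt (𝓡 n) x x) (WithLp.toLp 2 c),
          outerNormal X x⟫ = 0 from h2, localRep_self]
      simp only [mul_zero, sub_zero, conj_trivial]
      exact mul_nonpos_of_nonneg_of_nonpos (by positivity) h3)
    rw [inner_smul_left] at h0
    simp only [conj_trivial] at h0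
    have : ⟪hessianMap X x (WithLp.toLp 2 c) (WithLp.toLp 2 c), outerNormal X x⟫ ≤ 0 := by
      unfold hessianMap
      linarith
    linarith

theorem secondForm_posDef (hX : IsConvexHypersurface X) {x : Sph n}
    (hK : 0 < gaussCurvature X x) : (secondForm X x).PosDef := by
  rw [(secondForm_posSemidef hX x).posDef_iff_det_ne_zero]
  intro h0
  rw [gaussCurvature, h0, zero_div] at hK
  exact lt_irrefl _ hK

end Hypersurface

/-- Near a point where a smooth map is an immersion, its deviation from the tangent planes is
quadratic in the chord length. -/
theorem exists_norm_sub_fderiv_le {E V : Type*} [NormedAddCommGroup E] [NormedSpace ℝ E]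
    [FiniteDimensional ℝ E] [NormedAddCommGroup V] [NormedSpace ℝ V] {φ : E → V}
    (hφ : ContDiff ℝ ∞ φ) {u : E} (hu : Function.Injective (fderiv ℝ φ u)) :
    ∃ r > 0, ∃ C : ℝ, 0 ≤ C ∧ ∀ a ∈ ball u r, ∀ b ∈ ball u r,
      ‖φ b - φ a - fderiv ℝ φ a (b - a)‖ ≤ C * ‖φ b - φ a‖ ^ 2 := by
  have hd : Differentiable ℝ φ := hφ.differentiable (by simp)
  obtain ⟨M, t, ht, hM⟩ :=
    ((hφ.fderiv_right (m := ∞) (by simp)).of_le (by simp)).contDiffAt.exists_lipschitzOnWith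
      (x := u)
  obtain ⟨A, hA0, hA⟩ := (fderiv ℝ φ u).toLinearMap.injective_iff_antilipschitz.1 hu
  have hstrict : HasStrictFDerivAt φ (fderiv ℝ φ u) u :=
    hφ.contDiffAt.hasStrictFDerivAt (by simp)
  have hA0' : (0 : ℝ) < A := by exact_mod_cast hA0
  -- The differential at u expands lengths by at least 1/A; an error of half that rate can be
  -- absorbed, leaving ‖b - a‖ ≤ 2A ‖φ b - φ a‖.
  have hlo := hstrict.isLittleO.def (c := 1 / (2 * A)) (by positivity)
  rw [nhds_prod_eq] at hlo
  obtain ⟨t', ht', hlo⟩ := mem_prod_same_iff.1 hlo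
  obtain ⟨r, hr, hball⟩ := Metric.mem_nhds_iff.1 (inter_mem ht ht')
  refine ⟨r, hr, 4 * M * A ^ 2, by positivity, fun a ha b hb => ?_⟩
  have h1 : ‖φ b - φ a - fderiv ℝ φ a (b - a)‖ ≤ M * ‖b - a‖ * ‖b - a‖ := by
    refine (convex_segment a b).norm_image_sub_le_of_norm_hasFDerivWithin_le'
      (f' := fderiv ℝ φ) (fun y _ => (hd y).hasFDerivAt.hasFDerivWithinAt) (fun y hy => ?_)
      (left_mem_segment ℝ a b) (right_mem_segment ℝ a b)
    have hyt : y ∈ t := (hball ((convex_ball u r).segment_subset ha hb hy)).1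
    refine (hM.norm_sub_le hyt (hball ha).1).trans ?_
    gcongr
    rw [segment_eq_image'] at hy
    obtain ⟨s, hs, rfl⟩ := hy
    rw [add_sub_cancel_left, norm_smul, Real.norm_of_nonneg hs.1]
    exact mul_le_of_le_one_left (norm_nonneg _) hs.2
  have h2 : ‖b - a‖ ≤ 2 * A * ‖φ b - φ a‖ := by
    have e1 := hlo (mk_mem_prod (hball hb).2 (hball ha).2)
    simp only [mem_ofPred_eq] at e1
    have e2 := hA.le_mul_dist b a
    rw [dist_eq_norm, dist_eq_norm] at e2
    simp only [ContinuousLinearMap.coe_coe, ← map_sub] at e2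
    have e3 : ‖fderiv ℝ φ u (b - a)‖ ≤ ‖φ b - φ a‖ + 1 / (2 * A) * ‖b - a‖ := by
      have := norm_sub_le (φ b - φ a) (φ b - φ a - fderiv ℝ φ u (b - a))
      rw [sub_sub_cancel] at this
      exact this.trans (by gcongr)
    have e4 : (A : ℝ) * ‖fderiv ℝ φ u (b - a)‖ ≤ A * ‖φ b - φ a‖ + ‖b - a‖ / 2 := by
      refine (mul_le_mul_of_nonneg_left e3 hA0'.le).trans (le_of_eq ?_)
      field_simp
    linarith
  calc _ ≤ M * ‖b - a‖ * ‖b - a‖ := h1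
    _ ≤ M * (2 * A * ‖φ b - φ a‖) * (2 * A * ‖φ b - φ a‖) := by gcongr
    _ = _ := by ring

/-! ### Curvature bound for one hypersurface and local control of its support function. -/

section Curvature

variable {n : ℕ} {X Y : Sph n → Amb n}

theorem exists_quadratic_support_bound_near (hX : IsConvexHypersurface X) (x : Sph n) :
    ∃ U ∈ 𝓝 x, ∃ Λ : ℝ, 0 ≤ Λ ∧ ∀ a ∈ U, ∀ b ∈ U,
      ⟪X a - X b, outerNormal X a⟫ ≤ Λ * ‖X b - X a‖ ^ 2 := by
  obtain ⟨r, hr, C, hC, h⟩ := exists_norm_sub_fderiv_le (localRep_contDiff hX.smooth x)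
    (u := extChartAt (𝓡 n) x x) (tangentMap_injective hX x)
  refine ⟨_, eventually_exists_chart x (ball_mem_nhds _ hr), C, hC, ?_⟩
  rintro _ ⟨a, ha, rfl⟩ _ ⟨b, hb, rfl⟩
  have hv := outerNormal_spec hX ((extChartAt (𝓡 n) x).symm a)
  set v := outerNormal X ((extChartAt (𝓡 n) x).symm a)
  have horth := inner_fderiv_localRep_eq_zero hX.smooth (x := x) (u := a) hv.2.2 (b - a)
  refine le_trans ?_ (h a ha b hb)
  calc ⟪localRep X x a - localRep X x b, v⟫
      = ⟪-(localRep X x b - localRep X x a - fderiv ℝ (localRep X x) a (b - a)), v⟫ := by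
        rw [inner_neg_left, inner_sub_left (localRep X x b - localRep X x a), horth, sub_zero,
          ← inner_neg_left, neg_sub]
    _ ≤ _ := by
        refine (real_inner_le_norm _ _).trans ?_
        rw [hv.1, mul_one, norm_neg]

/-- Near the diagonal this is Taylor's formula; away from it chords have length bounded below by
injectivity, so Cauchy-Schwarz suffices. Compactness of the product joins the two, with no
regularity of x ↦ `outerNormal X x` needed. -/
theorem exists_quadratic_support_bound (hX : IsConvexHypersurface X) :
    ∃ Λ : ℝ, 0 ≤ Λ ∧ ∀ x y, ⟪X x - X y, outerNormal X x⟫ ≤ Λ * ‖X y - X x‖ ^ 2 := by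
  let p : Set (Sph n × Sph n) → Prop := fun U => ∃ Λ : ℝ, 0 ≤ Λ ∧ ∀ q ∈ U,
    ⟪X q.1 - X q.2, outerNormal X q.1⟫ ≤ Λ * ‖X q.2 - X q.1‖ ^ 2
  have key : p univ := by
    refine isCompact_univ.induction_on (p := p) ⟨0, le_rfl, by simp⟩ ?_ ?_ ?_
    · rintro U V hUV ⟨Λ, h0, h⟩
      exact ⟨Λ, h0, fun q hq => h q (hUV hq)⟩
    · rintro U V ⟨Λ, h0, h⟩ ⟨Λ', h0', h'⟩
      refine ⟨max Λ Λ', le_max_of_le_left h0, fun q hq => ?_⟩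
      rcases hq with hq | hq
      · exact (h q hq).trans (by gcongr; exact le_max_left _ _)
      · exact (h' q hq).trans (by gcongr; exact le_max_right _ _)
    rintro ⟨x, y⟩ -
    rw [nhdsWithin_univ]
    by_cases hxy : x = y
    · subst hxy
      obtain ⟨U, hU, Λ, h0, h⟩ := exists_quadratic_support_bound_near hX x
      exact ⟨U ×ˢ U, prod_mem_nhds hU hU, Λ, h0, fun q hq => h q.1 hq.1 q.2 hq.2⟩
    · have hd : 0 < ‖X y - X x‖ :=
        norm_pos_iff.2 (sub_ne_zero.2 fun h => hxy (hX.injective h).symm)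
      have hc := hX.smooth.continuous
      have hcont : Continuous fun q : Sph n × Sph n => ‖X q.2 - X q.1‖ := by fun_prop
      refine ⟨_, (hcont.tendsto (x, y)).eventually (lt_mem_nhds (half_lt_self hd)),
        2 / ‖X y - X x‖, by positivity, ?_⟩
      intro q hq
      have hq' : ‖X y - X x‖ / 2 < ‖X q.2 - X q.1‖ := hq
      refine (real_inner_le_norm _ _).trans ?_
      rw [(outerNormal_spec hX q.1).1, mul_one, norm_sub_rev, div_mul_eq_mul_div,
        le_div_iff₀ hd]
      nlinarith [norm_nonneg (X q.2 - X q.1)]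
  obtain ⟨Λ, h0, h⟩ := key
  exact ⟨Λ, h0, fun x y => h (x, y) (mem_univ _)⟩

/-- The Gauss curvature of a smooth closed convex hypersurface is bounded. -/
theorem exists_gaussCurvature_le (hn : 0 < n) (hX : IsConvexHypersurface X) :
    ∃ B : ℝ, ∀ x, gaussCurvature X x ≤ B := by
  obtain ⟨Λ, hΛ, h⟩ := exists_quadratic_support_bound hX
  refine ⟨(2 * Λ) ^ n, fun x => det_div_le_of_quadratic_le hn (metricMatrix_posDef hX x)
    (secondForm_posSemidef hX x) fun c => ?_⟩
  set w : EuclideanSpace ℝ (Fin n) := WithLp.toLp 2 c with hw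
  set u := extChartAt (𝓡 n) x x
  change w.ofLp ⬝ᵥ _ ≤ _ * (w.ofLp ⬝ᵥ _)
  rw [dotProduct_secondForm hX.smooth, dotProduct_metricMatrix]
  have hcd := localRep_contDiff hX.smooth x
  have h1 := (taylor_two_ray hcd u w).inner (𝕜 := ℝ) (tendsto_const_nhds (x := outerNormal X x))
  have h2 : Tendsto (fun t : ℝ => t⁻¹ • (localRep X x (u + t • w) - localRep X x u)) (𝓝[≠] 0)
      (𝓝 (tangentMap X x w)) :=
    ((hcd.differentiable (by simp) u).hasFDerivAt.hasLineDerivAt w).tendsto_slope_zero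
  have h3 := le_of_tendsto_of_tendsto h1.neg ((h2.norm.pow 2).const_mul Λ)
    (Eventually.of_forall fun t => by
      have hv := (outerNormal_spec hX x).2.2
      have e := h x ((extChartAt (𝓡 n) x).symm (u + t • w))
      change ⟪X x - localRep X x (u + t • w), outerNormal X x⟫ ≤
        Λ * ‖localRep X x (u + t • w) - X x‖ ^ 2 at e
      have e2 : ⟪fderiv ℝ (localRep X x) u w, outerNormal X x⟫ = 0 :=
        inner_tangentMap_eq_zero hX.smooth hv w
      have e3 : localRep X x u = X x := localRep_self X x
      simp only [inner_smul_left, inner_sub_left, e2, e3, norm_smul, mul_pow, conj_trivial,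
        norm_inv, Real.norm_eq_abs, inv_pow, sq_abs, mul_zero, sub_zero] at e ⊢
      have ht : 0 ≤ (t ^ 2)⁻¹ := by positivity
      nlinarith [mul_le_mul_of_nonneg_left e ht])
  rw [inner_smul_left] at h3
  simp only [conj_trivial] at h3
  change -(1 / 2 * ⟪hessianMap X x w w, outerNormal X x⟫) ≤ _ at h3
  linarith

theorem exists_coercive (hX : IsConvexHypersurface X) {x : Sph n} (hK : 0 < gaussCurvature X x) :
    ∃ m > 0, ∀ w, m * ‖w‖ ^ 2 ≤ -⟪hessianMap X x w w, outerNormal X x⟫ := by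
  set q : EuclideanSpace ℝ (Fin n) → ℝ := fun w => -⟪hessianMap X x w w, outerNormal X x⟫ with hq
  have hqc : Continuous q := by fun_prop
  have hpos : ∀ w, w ≠ 0 → 0 < q w := by
    intro w hw
    have h := (secondForm_posDef hX hK).dotProduct_mulVec_pos (x := w.ofLp)
      (fun h0 => hw (by ext i; exact congrFun h0 i))
    rwa [star_trivial, dotProduct_secondForm hX.smooth] at h
  have hsc : ∀ (t : ℝ) w, q (t • w) = t ^ 2 * q w := by
    intro t w
    simp only [hq, map_smul, smul_apply, inner_smul_left, conj_trivial]
    ring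
  obtain ⟨m, hm, hmw⟩ : ∃ m > 0, ∀ w ∈ sphere (0 : EuclideanSpace ℝ (Fin n)) 1, m ≤ q w := by
    rcases (sphere (0 : EuclideanSpace ℝ (Fin n)) 1).eq_empty_or_nonempty with h | h
    · exact ⟨1, one_pos, by simp [h]⟩
    · obtain ⟨w, hw, hmin⟩ := (isCompact_sphere _ _).exists_isMinOn h hqc.continuousOn
      exact ⟨q w, hpos w (ne_zero_of_mem_unit_sphere ⟨w, hw⟩), fun v hv => hmin hv⟩
  refine ⟨m, hm, fun w => ?_⟩
  rcases eq_or_ne w 0 with rfl | hw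
  · simp
  · have hw' : 0 < ‖w‖ := norm_pos_iff.2 hw
    have h1 := hmw (‖w‖⁻¹ • w) (by simp [norm_smul, hw'.ne'])
    rw [hsc, inv_pow, ← div_eq_inv_mul, le_div_iff₀ (by positivity)] at h1
    exact h1

/-- Near `x`, the height of the hypersurface in directions close to the normal is controlled by
the second fundamental form. -/
theorem exists_local_support_bound (hX : IsConvexHypersurface X) {x : Sph n}
    (hK : 0 < gaussCurvature X x) (e : Amb n) {l : ℝ} (hl : l < 1) :
    ∃ r > 0, ∀ w : EuclideanSpace ℝ (Fin n), ‖w‖ < r → ∀ ε : ℝ, |ε| < r →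
      ⟪localRep X x (extChartAt (𝓡 n) x x + w) - X x, outerNormal X x + ε • e⟫ ≤
        ε * ⟪tangentMap X x w, e⟫ + l / 2 * ⟪hessianMap X x w w, outerNormal X x⟫ := by
  obtain ⟨m, hm, hmq⟩ := exists_coercive hX hK
  set v := outerNormal X x with hv
  have hvs := outerNormal_spec hX x
  -- Two errors of size η‖w‖² occur, one from the Taylor remainder and one from tilting the normal;
  -- coercivity makes their sum at most the fraction (1 - l)/2 of the second fundamental form given
  -- up in the conclusion.
  set η := (1 - l) * m / 4 with hη
  have hη0 : 0 < η := by have := sub_pos.2 hl; positivity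
  obtain ⟨r, hr, hT⟩ := Metric.eventually_nhds_iff_ball.1
    (taylor_two (localRep_contDiff hX.smooth x) (extChartAt (𝓡 n) x x) hη0)
  set N := (1 / 2 * ‖hessianMap X x‖ + η) * ‖e‖ with hN
  have hN0 : 0 ≤ N := by positivity
  refine ⟨min r (η / (N + 1)), lt_min hr (by positivity), fun w hw ε hε => ?_⟩
  have hR := hT w (by simpa using hw.trans_le (min_le_left _ _))
  change ‖_ - _ - tangentMap X x w - (1 / 2 : ℝ) • hessianMap X x w w‖ ≤ _ at hR
  rw [localRep_self] at hR
  set R := localRep X x (extChartAt (𝓡 n) x x + w) - X x - tangentMap X x w -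
    (1 / 2 : ℝ) • hessianMap X x w w with hRdef
  have hdec : localRep X x (extChartAt (𝓡 n) x x + w) - X x =
      R + tangentMap X x w + (1 / 2 : ℝ) • hessianMap X x w w := by rw [hRdef]; abel
  have hTv : ⟪tangentMap X x w, v⟫ = 0 := inner_tangentMap_eq_zero hX.smooth hvs.2.2 w
  have h1 : ⟪R, v⟫ ≤ η * ‖w‖ ^ 2 := by
    refine (real_inner_le_norm _ _).trans ?_
    rwa [hvs.1, mul_one]
  have h2 : ε * ⟪R + (1 / 2 : ℝ) • hessianMap X x w w, e⟫ ≤ η * ‖w‖ ^ 2 := by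
    have hH : ‖R + (1 / 2 : ℝ) • hessianMap X x w w‖ ≤
        (1 / 2 * ‖hessianMap X x‖ + η) * ‖w‖ ^ 2 := by
      refine (norm_add_le _ _).trans ?_
      have := (hessianMap X x).le_opNorm₂ w w
      rw [norm_smul, Real.norm_of_nonneg (by norm_num)]
      nlinarith
    have hε' : |ε| * N ≤ η := by
      have h3 : |ε| < η / (N + 1) := hε.trans_le (min_le_right _ _)
      rw [lt_div_iff₀ (by positivity)] at h3
      nlinarith [abs_nonneg ε]
    calc _ ≤ |ε * ⟪R + (1 / 2 : ℝ) • hessianMap X x w w, e⟫| := le_abs_self _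
      _ ≤ |ε| * (‖R + (1 / 2 : ℝ) • hessianMap X x w w‖ * ‖e‖) := by
        rw [abs_mul]
        gcongr
        exact abs_real_inner_le_norm _ _
      _ ≤ |ε| * ((1 / 2 * ‖hessianMap X x‖ + η) * ‖w‖ ^ 2 * ‖e‖) := by gcongr
      _ = |ε| * N * ‖w‖ ^ 2 := by rw [hN]; ring
      _ ≤ _ := by gcongr
  have h3 := hmq w
  have h4 : 2 * η * ‖w‖ ^ 2 ≤ (1 - l) / 2 * -⟪hessianMap X x w w, v⟫ := by
    have := mul_le_mul_of_nonneg_left h3 (by linarith : 0 ≤ (1 - l) / 2)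
    rw [hη]
    linarith
  rw [hdec]
  simp only [inner_add_left, inner_add_right, inner_smul_left, inner_smul_right, conj_trivial,
    hTv] at h2 ⊢
  linarith

/-- A hypersurface of positive curvature meets its tangent planes in one point only. -/
theorem eq_of_inner_outerNormal_eq_zero (hX : IsConvexHypersurface X) {x y : Sph n}
    (hK : 0 < gaussCurvature X x) (h : ⟪X y - X x, outerNormal X x⟫ = 0) : y = x := by
  by_contra hne
  have hvs := outerNormal_spec hX x
  obtain ⟨m, hm, hmq⟩ := exists_coercive hX hK
  obtain ⟨r, hr, hloc⟩ := exists_local_support_bound hX hK 0 (l := 1 / 2) (by norm_num)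
  have hnear : ∀ᶠ y' in 𝓝 x, ⟪X y' - X x, outerNormal X x⟫ = 0 → X y' = X x := by
    filter_upwards [eventually_exists_chart x (ball_mem_nhds _ hr)] with y' hy' h0
    obtain ⟨u, hu, rfl⟩ := hy'
    have h1 := hloc (u - extChartAt (𝓡 n) x x) (by rwa [← dist_eq_norm]) 0 (by simpa using hr)
    have h2 := hmq (u - extChartAt (𝓡 n) x x)
    rw [add_sub_cancel] at h1
    change ⟪X ((extChartAt (𝓡 n) x).symm u) - X x, _⟫ ≤ _ at h1
    rw [zero_smul, add_zero, h0] at h1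
    have h3 : ‖u - extChartAt (𝓡 n) x x‖ ^ 2 = 0 := by
      have : 0 ≤ ‖u - extChartAt (𝓡 n) x x‖ ^ 2 := sq_nonneg _
      nlinarith
    have h4 : u = extChartAt (𝓡 n) x x := by
      rw [← sub_eq_zero, ← norm_eq_zero]; exact pow_eq_zero_iff (two_ne_zero) |>.1 h3
    rw [h4, extChartAt_to_inv]
  -- Points of the segment from X x to X y lie in the body and in a supporting hyperplane, hence on
  -- the hypersurface. Those close to X x have parameters close to x, where the contact with the
  -- hyperplane is strict.
  have hemb := hX.smooth.continuous.isClosedEmbedding hX.injective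
  rw [hemb.isInducing.nhds_eq_comap, eventually_comap] at hnear
  have hpath : Tendsto (fun s : ℝ => X x + s • (X y - X x)) (𝓝[>] 0) (𝓝 (X x)) := by
    have : Continuous fun s : ℝ => X x + s • (X y - X x) := by fun_prop
    exact (this.tendsto' 0 _ (by simp)).mono_left nhdsWithin_le_nhds
  obtain ⟨s, hs, hs0, hs1⟩ := ((hpath.eventually hnear).and
    (Ioo_mem_nhdsGT (zero_lt_one' ℝ))).exists
  set p := X x + s • (X y - X x) with hp
  have hpΩ : p ∈ enclosedBody X :=
    (enclosedBody_convex X).add_smul_sub_mem (mem_enclosedBody X x) (mem_enclosedBody X y)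
      ⟨hs0.le, hs1.le⟩
  have hpin : ⟪p, outerNormal X x⟫ = ⟪X x, outerNormal X x⟫ := by
    rw [hp, inner_add_left, inner_smul_left, h, mul_zero, add_zero]
  have hpni : p ∉ interior (enclosedBody X) := by
    intro hpi
    obtain ⟨t, ht, hb⟩ := Metric.mem_nhds_iff.1 (mem_interior_iff_mem_nhds.1 hpi)
    have hq : p + (t / 2) • outerNormal X x ∈ enclosedBody X := hb (by
      rw [mem_ball, dist_eq_norm, add_sub_cancel_left, norm_smul, hvs.1, mul_one,
        Real.norm_of_nonneg (by positivity)]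
      linarith)
    have := inner_le_of_mem_enclosedBody (c := ⟪X x, outerNormal X x⟫) (fun y => by
      have := hvs.2.2 y; rw [inner_sub_left] at this; linarith) hq
    rw [inner_add_left, hpin, inner_smul_left, real_inner_self_eq_norm_sq, hvs.1] at this
    simp at this
    linarith
  have hpr : p ∈ range X := hX.range_eq ▸ ⟨subset_closure hpΩ, hpni⟩
  obtain ⟨y', hy'⟩ := hpr
  have h1 := hs y' hy' (by rw [hy', inner_sub_left, hpin, sub_self])
  rw [hy', hp, add_eq_left, smul_eq_zero] at h1
  rcases h1 with h1 | h1
  · exact hs0.ne' h1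
  · exact hne (hX.injective (sub_eq_zero.1 h1))

/-- Second order upper bound for the support function near a normal direction. -/
theorem eventually_support_le (hX : IsConvexHypersurface X) {x : Sph n}
    (hK : 0 < gaussCurvature X x) (e : Amb n) {l : ℝ} (hl0 : 0 < l) (hl : l < 1) :
    ∀ᶠ ε in 𝓝 (0 : ℝ), ∀ y, ⟪X y - X x, outerNormal X x + ε • e⟫ ≤ ε ^ 2 / (2 * l) *
      ((fun i => ⟪coordD X x i, e⟫) ⬝ᵥ
        (secondForm X x)⁻¹.mulVec (fun i => ⟪coordD X x i, e⟫)) := by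
  obtain ⟨r, hr, hloc⟩ := exists_local_support_bound hX hK e hl
  have hh := secondForm_posDef hX hK
  have hnear := eventually_exists_chart x (ball_mem_nhds (extChartAt (𝓡 n) x x) hr)
  obtain ⟨U, hU, hUo, hxU⟩ := _root_.mem_nhds_iff.1 hnear
  -- Outside a neighbourhood of x the height is strictly negative at ε = 0, and compactness keeps it
  -- so for small ε.
  have hfar : ∀ᶠ ε in 𝓝 (0 : ℝ), ∀ y ∈ Uᶜ, ⟪X y - X x, outerNormal X x + ε • e⟫ < 0 := by
    refine hUo.isClosed_compl.isCompact.eventually_forall_of_forall_eventually fun y hy => ?_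
    have hc : Continuous fun p : ℝ × Sph n => ⟪X p.2 - X x, outerNormal X x + p.1 • e⟫ := by
      have := hX.smooth.continuous
      fun_prop
    refine (hc.tendsto (0, y)).eventually (gt_mem_nhds ?_)
    simp only [zero_smul, add_zero]
    refine lt_of_le_of_ne ((outerNormal_spec hX x).2.2 y) fun h0 => hy ?_
    rw [eq_of_inner_outerNormal_eq_zero hX hK h0]
    exact hxU
  filter_upwards [hfar, Metric.ball_mem_nhds (0 : ℝ) hr] with ε h1 h2 y
  by_cases hy : y ∈ U
  · obtain ⟨u, hu, rfl⟩ := hU hy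
    have h3 := hloc (u - extChartAt (𝓡 n) x x) (by rwa [← dist_eq_norm]) ε (by simpa using h2)
    rw [add_sub_cancel] at h3
    refine le_trans h3 ?_
    set w := u - extChartAt (𝓡 n) x x
    have h4 := dotProduct_le_young hh hl0 (fun i => ⟪coordD X x i, e⟫) w.ofLp ε
    have h5 : ⟪tangentMap X x w, e⟫ = w.ofLp ⬝ᵥ fun i => ⟪coordD X x i, e⟫ := by
      rw [tangentMap_apply, sum_inner]
      exact Finset.sum_congr rfl fun i _ => by rw [inner_smul_left]; simp
    rw [dotProduct_secondForm hX.smooth] at h4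
    rw [h5]
    linarith
  · refine (h1 y hy).le.trans ?_
    have := hh.inv.posSemidef.dotProduct_mulVec_nonneg (fun i => ⟪coordD X x i, e⟫)
    rw [star_trivial] at this
    positivity

end Curvature

/-! ### Comparison of curvatures when scaled and shifted support functions touch. -/

section Touching

variable {n : ℕ} {X Y : Sph n → Amb n}

/-- Second order expansion of ‖z + εa‖ for a unit vector z orthogonal to a; it produces the term
μ‖a‖² of `curvature_comparison`. -/
theorem tendsto_sqrt_one_add_sub_one (a : ℝ) :
    Tendsto (fun ε : ℝ => (ε ^ 2)⁻¹ * (√(1 + ε ^ 2 * a ^ 2) - 1)) (𝓝[≠] 0) (𝓝 (a ^ 2 / 2)) := by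
  have h : Tendsto (fun ε : ℝ => a ^ 2 / (√(1 + ε ^ 2 * a ^ 2) + 1)) (𝓝[≠] 0)
      (𝓝 (a ^ 2 / 2)) := by
    have hc : Continuous fun ε : ℝ => a ^ 2 / (√(1 + ε ^ 2 * a ^ 2) + 1) := by
      refine continuous_const.div (by fun_prop) fun ε => ?_
      positivity
    exact (hc.tendsto' 0 _ (by norm_num)).mono_left nhdsWithin_le_nhds
  refine h.congr' ?_
  filter_upwards [self_mem_nhdsWithin] with ε hε
  have hε0 : ε ≠ 0 := hε
  have h1 := Real.sq_sqrt (by positivity : 0 ≤ 1 + ε ^ 2 * a ^ 2)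
  have h2 : √(1 + ε ^ 2 * a ^ 2) + 1 ≠ 0 := by positivity
  generalize √(1 + ε ^ 2 * a ^ 2) = s at h1 h2 ⊢
  field_simp
  linear_combination -h1

theorem norm_add_smul_of_orthogonal {z a : Amb n} (hz : ‖z‖ = 1) (ha : ⟪a, z⟫ = 0) (ε : ℝ) :
    ‖z + ε • a‖ = √(1 + ε ^ 2 * ‖a‖ ^ 2) := by
  rw [← Real.sqrt_sq (norm_nonneg (z + ε • a)), norm_add_sq_real, hz, inner_smul_right,
    real_inner_comm, ha, norm_smul, mul_pow, Real.norm_eq_abs, sq_abs]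
  norm_num

/-- Comparison of the Gauss curvatures of two convex hypersurfaces whose support functions (with
respect to `c`) satisfy `s_Y ≤ ρ s_X - μ`, with equality in the direction `z`. -/
theorem touching_comparison (hn : 0 < n) (hX : IsConvexHypersurface X)
    (hY : IsConvexHypersurface Y) {x y : Sph n} (hKX : 0 < gaussCurvature X x)
    (hKY : 0 < gaussCurvature Y y) {z c : Amb n} (hzX : outerNormal X x = z)
    (hzY : outerNormal Y y = z) {ρ μ κ : ℝ} (hρ : 0 ≤ ρ) (hμ : 0 ≤ μ)
    (hκ : κ ^ n = gaussCurvature X x)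
    (hle : ∀ y' ζ, ∃ x', ⟪Y y' - c, ζ⟫ ≤ ρ * ⟪X x' - c, ζ⟫ - μ * ‖ζ‖)
    (heq : ⟪Y y - c, z⟫ = ρ * ⟪X x - c, z⟫ - μ) :
    κ ^ n / gaussCurvature Y y ≤ (ρ - μ * κ) ^ n ∧ 0 ≤ ρ - μ * κ := by
  have hsX := outerNormal_spec hX x
  have hsY := outerNormal_spec hY y
  rw [hzX] at hsX
  rw [hzY] at hsY
  refine curvature_comparison hn hsX.1 (hX.immersion x) (hY.immersion y) hsX.2.1 hsY.2.1
    (secondForm_posDef hX hKX) (secondForm_posDef hY hKY) hμ hκ ?_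
  intro w a haz
  set Q := (fun i => ⟪coordD X x i, a⟫) ⬝ᵥ
    (secondForm X x)⁻¹.mulVec (fun i => ⟪coordD X x i, a⟫) with hQ
  set W : EuclideanSpace ℝ (Fin n) := WithLp.toLp 2 w with hW
  set u := extChartAt (𝓡 n) y y with hu
  set ψ := localRep Y y with hψ
  have hψu : ψ u = Y y := localRep_self Y y
  have hDw : ∑ i, w i • coordD Y y i = tangentMap Y y W := (tangentMap_apply Y y W).symm
  have hk : w ⬝ᵥ (secondForm Y y).mulVec w = -⟪hessianMap Y y W W, z⟫ := by
    rw [← hzY]; exact dotProduct_secondForm hY.smooth y W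
  rw [hDw, hk]
  have hTz : ⟪tangentMap Y y W, z⟫ = 0 := inner_tangentMap_eq_zero hY.smooth hsY.2.2 W
  -- the remainder of the first order expansion of `Y` along a ray
  set A : ℝ → Amb n := fun ε => (ε ^ 2)⁻¹ • (ψ (u + ε • W) - ψ u - ε • tangentMap Y y W) with hA
  have hAlim : Tendsto A (𝓝[≠] 0) (𝓝 ((1 / 2 : ℝ) • hessianMap Y y W W)) :=
    taylor_two_ray (localRep_contDiff hY.smooth y) u W
  have hneg : Tendsto (fun ε : ℝ => -ε) (𝓝[≠] 0) (𝓝[≠] 0) := by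
    refine tendsto_nhdsWithin_iff.2 ⟨?_, ?_⟩
    · exact (continuous_neg.tendsto' 0 0 neg_zero).mono_left nhdsWithin_le_nhds
    · filter_upwards [self_mem_nhdsWithin] with ε hε
      exact neg_ne_zero.2 hε
  have hzlim : Tendsto (fun ε : ℝ => z + ε • a) (𝓝[≠] 0) (𝓝 z) := by
    have : Continuous fun ε : ℝ => z + ε • a := by fun_prop
    exact (this.tendsto' 0 _ (by simp)).mono_left nhdsWithin_le_nhds
  have hB : Tendsto (fun ε => ⟪A ε, z + ε • a⟫) (𝓝[≠] 0)
      (𝓝 ⟪(1 / 2 : ℝ) • hessianMap Y y W W, z⟫) := hAlim.inner (𝕜 := ℝ) hzlim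
  have key : ∀ l : ℝ, 0 < l → l < 1 → 2 * ⟪tangentMap Y y W, a⟫ - -⟪hessianMap Y y W W, z⟫ ≤
      ρ * (l⁻¹ * Q) - μ * ‖a‖ ^ 2 := by
    intro l hl0 hl1
    have hup := eventually_support_le hX hKX a hl0 hl1
    rw [hzX] at hup
    have one_sided : ∀ᶠ ε in 𝓝[≠] (0 : ℝ), ε ^ 2 * ⟪A ε, z + ε • a⟫ +
        ε ^ 2 * ⟪tangentMap Y y W, a⟫ + ε * (⟪Y y - c, a⟫ - ρ * ⟪X x - c, a⟫) ≤
          ρ * (ε ^ 2 / (2 * l) * Q) - μ * (√(1 + ε ^ 2 * ‖a‖ ^ 2) - 1) := by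
      filter_upwards [nhdsWithin_le_nhds hup, self_mem_nhdsWithin] with ε h1 h2
      have hε : ε ≠ 0 := h2
      -- The point on Y moves along W while the direction tilts along a, independently of each
      -- other; the mixed term of order ε² is ⟪tangentMap Y y W, a⟫.
      obtain ⟨x', hx'⟩ := hle ((extChartAt (𝓡 n) y).symm (u + ε • W)) (z + ε • a)
      change ⟪ψ (u + ε • W) - c, _⟫ ≤ _ at hx'
      have h3 := h1 x'
      have h4 : ψ (u + ε • W) - c = ε ^ 2 • A ε + ε • tangentMap Y y W + (Y y - c) := by
        rw [hA, smul_smul, mul_inv_cancel₀ (pow_ne_zero 2 hε), one_smul, hψu]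
        abel
      have h5 : ⟪X x' - c, z + ε • a⟫ = ⟪X x' - X x, z + ε • a⟫ + ⟪X x - c, z + ε • a⟫ := by
        rw [← inner_add_left, sub_add_sub_cancel]
      have h6 : ⟪X x' - c, z + ε • a⟫ ≤ ε ^ 2 / (2 * l) * Q + ⟪X x - c, z + ε • a⟫ := by
        rw [h5]; gcongr
      have h7 := hx'.trans (sub_le_sub_right (mul_le_mul_of_nonneg_left h6 hρ) _)
      rw [h4, norm_add_smul_of_orthogonal hsX.1 haz, inner_add_left, inner_add_left,
        inner_smul_left (A ε), inner_smul_left (tangentMap Y y W),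
        inner_add_right (tangentMap Y y W), hTz,
        inner_add_right (Y y - c), inner_add_right (X x - c), heq] at h7
      simp only [inner_smul_right, conj_trivial] at h7
      linarith
    -- Adding the inequalities for ε and -ε cancels the first order term ⟪Y y - c, a⟫ - ρ⟪X x - c,
    -- a⟫, whose vanishing need not be known.
    have two_sided : ∀ᶠ ε in 𝓝[≠] (0 : ℝ), ⟪A ε, z + ε • a⟫ + ⟪A (-ε), z + (-ε) • a⟫ +
        2 * ⟪tangentMap Y y W, a⟫ ≤
          ρ * (l⁻¹ * Q) - 2 * μ * ((ε ^ 2)⁻¹ * (√(1 + ε ^ 2 * ‖a‖ ^ 2) - 1)) := by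
      filter_upwards [one_sided, hneg.eventually one_sided, self_mem_nhdsWithin] with ε h1 h2 h3
      have hε : ε ≠ 0 := h3
      rw [neg_sq] at h2
      have h4 := add_le_add h1 h2
      have hpos : 0 < ε ^ 2 := by positivity
      refine le_of_mul_le_mul_left ?_ hpos
      have h5 : ε ^ 2 * (ρ * (l⁻¹ * Q) - 2 * μ * ((ε ^ 2)⁻¹ * (√(1 + ε ^ 2 * ‖a‖ ^ 2) - 1))) =
          2 * (ρ * (ε ^ 2 / (2 * l) * Q) - μ * (√(1 + ε ^ 2 * ‖a‖ ^ 2) - 1)) := by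
        field_simp
      rw [h5]
      linarith
    have hlim := le_of_tendsto_of_tendsto ((hB.add (hB.comp hneg)).add_const _)
      (((tendsto_sqrt_one_add_sub_one ‖a‖).const_mul (2 * μ)).const_sub (ρ * (l⁻¹ * Q))) two_sided
    rw [inner_smul_left] at hlim
    simp only [conj_trivial] at hlim
    linarith
  have hl : Tendsto (fun l : ℝ => ρ * (l⁻¹ * Q) - μ * ‖a‖ ^ 2) (𝓝[<] 1)
      (𝓝 (ρ * Q - μ * ‖a‖ ^ 2)) := by
    have h1 : Tendsto (fun l : ℝ => l⁻¹) (𝓝[<] 1) (𝓝 1) := by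
      simpa using (tendsto_inv₀ (one_ne_zero (α := ℝ))).mono_left nhdsWithin_le_nhds
    simpa using ((h1.mul_const Q).const_mul ρ).sub_const (μ * ‖a‖ ^ 2)
  refine ge_of_tendsto hl ?_
  filter_upwards [Ioo_mem_nhdsLT (zero_lt_one' ℝ)] with l hl
  exact key l hl.1 hl.2

end Touching

/-! ### One-sided derivative tests and monotonicity. -/

section Calculus

theorem nonneg_of_hasDerivWithinAt_of_le {φ : ℝ → ℝ} {d t : ℝ} {s : Set ℝ}
    (hs : s ∈ 𝓝[<] t) (hd : HasDerivWithinAt φ d s t) (h : ∀ᶠ τ in 𝓝[<] t, φ τ ≤ φ t) :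
    0 ≤ d := by
  have h1 := (hasDerivWithinAt_iff_tendsto_slope' (by simp)).1 (hd.mono_of_mem_nhdsWithin hs)
  refine ge_of_tendsto h1 ?_
  filter_upwards [h, self_mem_nhdsWithin] with τ h2 h3
  have h4 : τ < t := h3
  rw [slope_def_field]
  exact div_nonneg_of_nonpos (by linarith) (by linarith)

theorem nonpos_of_hasDerivWithinAt_of_le {φ : ℝ → ℝ} {d t : ℝ} {s : Set ℝ}
    (hs : s ∈ 𝓝[>] t) (hd : HasDerivWithinAt φ d s t) (h : ∀ᶠ τ in 𝓝[>] t, φ τ ≤ φ t) :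
    d ≤ 0 := by
  have h1 := (hasDerivWithinAt_iff_tendsto_slope' (by simp)).1 (hd.mono_of_mem_nhdsWithin hs)
  refine le_of_tendsto h1 ?_
  filter_upwards [h, self_mem_nhdsWithin] with τ h2 h3
  have h4 : t < τ := h3
  rw [slope_def_field]
  exact div_nonpos_of_nonpos_of_nonneg (by linarith) (by linarith)

/-- If S p < S q with p ≤ q, the least τ in [p, q] with S τ ≥ S q exceeds p, and the hypothesis at τ
yields a smaller such point. -/
theorem antitoneOn_of_eventually_left {S : ℝ → ℝ} {a b : ℝ} (hS : ContinuousOn S (Icc a b))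
    (h : ∀ t ∈ Ioc a b, ∀ᶠ s in 𝓝[<] t, S t ≤ S s) : AntitoneOn S (Icc a b) := by
  intro p hp q hq hpq
  by_contra! hlt
  have hsub : Icc p q ⊆ Icc a b := Icc_subset_Icc hp.1 hq.2
  have hA : IsCompact (Icc p q ∩ S ⁻¹' Ici (S q)) :=
    isCompact_Icc.of_isClosed_subset
      ((hS.mono hsub).preimage_isClosed_of_isClosed isClosed_Icc isClosed_Ici) inter_subset_left
  obtain ⟨τ, ⟨hτ, hτS⟩, hleast⟩ :=
    hA.exists_isLeast ⟨q, mem_inter ⟨hpq, le_rfl⟩ (mem_preimage.2 self_mem_Ici)⟩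
  have hτp : p < τ := by
    refine lt_of_le_of_ne hτ.1 ?_
    rintro rfl
    exact absurd hτS (not_le.2 hlt)
  obtain ⟨s, hs1, hs2⟩ := ((h τ ⟨hp.1.trans_lt hτp, hτ.2.trans hq.2⟩).and
    (Ioo_mem_nhdsLT hτp)).exists
  have hs3 : S q ≤ S τ := hτS
  exact absurd (hleast ⟨⟨hs2.1.le, hs2.2.le.trans hτ.2⟩, hs3.trans hs1⟩) (not_le.2 hs2.2)

end Calculus

/-! ### Support functions and the points where they are attained. -/

section SupportFunction

variable {n : ℕ} {X : Sph n → Amb n}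

/-- The support function of the hypersurface parametrized by `X`. -/
def supportFn (X : Sph n → Amb n) (z : Amb n) : ℝ :=
  sSup ((fun y => ⟪X y, z⟫) '' univ)

instance : Nonempty (Sph n) := (NormedSpace.sphere_nonempty.2 zero_le_one).to_subtype

theorem exists_inner_eq_supportFn (hX : Continuous X) (z : Amb n) :
    ∃ x, ⟪X x, z⟫ = supportFn X z := by
  obtain ⟨x, -, hx⟩ := isCompact_univ.exists_sSup_image_eq (univ_nonempty (α := Sph n))
    (f := fun y => ⟪X y, z⟫) (by fun_prop)
  exact ⟨x, hx.symm⟩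

theorem inner_le_supportFn (hX : Continuous X) (y : Sph n) (z : Amb n) :
    ⟪X y, z⟫ ≤ supportFn X z :=
  le_csSup (isCompact_univ.image (by fun_prop)).bddAbove (mem_image_of_mem _ (mem_univ y))

theorem outerNormal_eq_of_inner_eq_supportFn (hX : IsConvexHypersurface X) {x : Sph n} {z : Amb n}
    (hz : ‖z‖ = 1) (h : ⟪X x, z⟫ = supportFn X z) : outerNormal X x = z :=
  outerNormal_eq hX hz fun y => by
    rw [inner_sub_left, h]
    exact sub_nonpos.2 (inner_le_supportFn hX.smooth.continuous y z)

theorem inner_outerNormal_eq_supportFn (hX : IsConvexHypersurface X) (x : Sph n) :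
    ⟪X x, outerNormal X x⟫ = supportFn X (outerNormal X x) := by
  obtain ⟨y, hy⟩ := exists_inner_eq_supportFn hX.smooth.continuous (outerNormal X x)
  refine le_antisymm (inner_le_supportFn hX.smooth.continuous x _) ?_
  have := (outerNormal_spec hX x).2.2 y
  rw [inner_sub_left] at this
  linarith

theorem inner_le_supportFn_of_mem (hX : Continuous X) {p : Amb n} (hp : p ∈ enclosedBody X)
    (z : Amb n) : ⟪p, z⟫ ≤ supportFn X z :=
  inner_le_of_mem_enclosedBody (fun y => inner_le_supportFn hX y z) hp

theorem le_supportFn_of_closedBall_subset (hX : Continuous X) {c z : Amb n} {r : ℝ} (hr : 0 ≤ r)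
    (h : closedBall c r ⊆ enclosedBody X) (hz : ‖z‖ = 1) : r ≤ supportFn X z - ⟪c, z⟫ := by
  have hp : c + r • z ∈ enclosedBody X := h (by
    rw [mem_closedBall, dist_eq_norm, add_sub_cancel_left, norm_smul, hz, mul_one,
      Real.norm_of_nonneg hr])
  have := inner_le_supportFn_of_mem hX hp z
  rw [inner_add_left, inner_smul_left, real_inner_self_eq_norm_sq, hz] at this
  simp at this
  linarith

end SupportFunction

/-! ### Time regularity of the support function along the flow. -/

section Flow

variable {n : ℕ} {f : ℝ → ℝ} {X₀ : Sph n → Amb n} {T : EReal} {F : ℝ → Sph n → Amb n} {t₁ : ℝ}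

theorem Icc_subset_timeInterval (ht₁ : t₁ ∈ timeInterval T) : Icc 0 t₁ ⊆ timeInterval T :=
  fun _ ht => ⟨ht.1, lt_of_le_of_lt (EReal.coe_le_coe_iff.2 ht.2) ht₁.2⟩

theorem IsFlow.continuousOn (hF : IsFlow f X₀ T F) (ht₁ : t₁ ∈ timeInterval T) :
    ContinuousOn (fun p : Sph n × ℝ => F p.2 p.1) (univ ×ˢ Icc 0 t₁) :=
  hF.smooth.continuousOn.mono (prod_mono_right (Icc_subset_timeInterval ht₁))

theorem IsFlow.continuous_restrict (hF : IsFlow f X₀ T F) (ht₁ : t₁ ∈ timeInterval T) :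
    Continuous fun p : Sph n × Icc 0 t₁ => F p.2 p.1 :=
  (hF.continuousOn ht₁).comp_continuous (f := fun p : Sph n × Icc 0 t₁ => (p.1, (p.2 : ℝ)))
    (by fun_prop) fun p => ⟨mem_univ _, p.2.2⟩

theorem IsFlow.continuous_supportFn (hF : IsFlow f X₀ T F) (ht₁ : t₁ ∈ timeInterval T) :
    Continuous fun p : Amb n × Icc 0 t₁ => supportFn (F p.2) p.1 := by
  have hc := hF.continuous_restrict ht₁
  refine IsCompact.continuous_sSup (f := fun (p : Amb n × Icc 0 t₁) y => ⟪F p.2 y, p.1⟫)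
    isCompact_univ ?_
  have h1 : Continuous fun q : (Amb n × Icc 0 t₁) × Sph n => F q.1.2 q.2 :=
    hc.comp (f := fun q : (Amb n × Icc 0 t₁) × Sph n => (q.2, q.1.2)) (by fun_prop)
  exact h1.inner (by fun_prop)

theorem IsFlow.contDiffOn_localRep (hF : IsFlow f X₀ T F) (y : Sph n) :
    ContDiffOn ℝ ∞ (fun p : EuclideanSpace ℝ (Fin n) × ℝ => localRep (F p.2) y p.1)
      (univ ×ˢ timeInterval T) := by
  have h1 := contMDiffOn_extChartAt_symm (I := 𝓡 n) (n := ∞) y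
  have ht : (extChartAt (𝓡 n) y).target = univ := by
    simp [chartAt, ChartedSpace.chartAt]
  rw [ht, contMDiffOn_univ] at h1
  have h2 : ContMDiff (𝓘(ℝ, EuclideanSpace ℝ (Fin n)).prod 𝓘(ℝ, ℝ)) ((𝓡 n).prod 𝓘(ℝ, ℝ)) ∞
      (Prod.map (extChartAt (𝓡 n) y).symm (id : ℝ → ℝ)) := h1.prodMap contMDiff_id
  have h3 := hF.smooth.comp h2.contMDiffOn (s := univ ×ˢ timeInterval T)
    fun p hp => ⟨mem_univ _, hp.2⟩
  rw [← modelWithCornersSelf_prod, chartedSpaceSelf_prod] at h3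
  exact contMDiffOn_iff_contDiffOn.1 h3

/-- The time derivative of the flow is uniform in space. -/
theorem IsFlow.eventually_norm_sub_le (hF : IsFlow f X₀ T F) (ht₁ : t₁ ∈ timeInterval T)
    (h0 : 0 < t₁) {t : ℝ} (ht : t ∈ Icc 0 t₁) (y : Sph n) {η : ℝ} (hη : 0 < η) :
    ∃ U ∈ 𝓝 y, ∃ r > 0, ∀ y' ∈ U, ∀ τ ∈ Icc 0 t₁, |τ - t| < r →
      ‖F τ y' - F t y' + (τ - t) • f (gaussCurvature (F t) y) • outerNormal (F t) y‖ ≤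
        η * |τ - t| := by
  set G : EuclideanSpace ℝ (Fin n) × ℝ → Amb n := fun p => localRep (F p.2) y p.1 with hG
  set u := extChartAt (𝓡 n) y y
  set s : Set (EuclideanSpace ℝ (Fin n) × ℝ) := univ ×ˢ Icc 0 t₁ with hs
  have hsub := Icc_subset_timeInterval ht₁
  have hGs : ContDiffOn ℝ ∞ G s := (hF.contDiffOn_localRep y).mono (prod_mono_right hsub)
  have hu : UniqueDiffOn ℝ s := uniqueDiffOn_univ.prod (uniqueDiffOn_Icc h0)
  have hcont : ContinuousOn (fderivWithin ℝ G s) s := hGs.continuousOn_fderivWithin hu (by simp)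
  have hd : ∀ p ∈ s, HasFDerivWithinAt G (fderivWithin ℝ G s p) s p := fun p hp =>
    (hGs.differentiableOn (by simp) p hp).hasFDerivWithinAt
  have hmem : (u, t) ∈ s := ⟨mem_univ _, ht⟩
  set D := fderivWithin ℝ G s (u, t) with hD
  have hDt : D (0, 1) = -(f (gaussCurvature (F t) y) • outerNormal (F t) y) := by
    have h1 : HasDerivWithinAt (fun τ : ℝ => (u, τ)) ((0 : EuclideanSpace ℝ (Fin n)), (1 : ℝ))
        (Icc 0 t₁) t := (hasDerivWithinAt_const t _ u).prodMk (hasDerivWithinAt_id t _)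
    have h2 := (hd _ hmem).comp_hasDerivWithinAt t h1 fun τ hτ => ⟨mem_univ _, hτ⟩
    have h3 := (hF.evolution t (hsub ht) y).mono hsub
    refine (uniqueDiffOn_Icc h0 t ht).eq_deriv _ h2 (h3.congr (fun τ _ => ?_) ?_) <;>
      exact localRep_self _ y
  have hev := (hcont (u, t) hmem).eventually (Metric.closedBall_mem_nhds D hη)
  obtain ⟨r, hr, hball⟩ := Metric.mem_nhdsWithin_iff.1 hev
  refine ⟨_, eventually_exists_chart y (ball_mem_nhds u hr), r, hr, ?_⟩
  rintro _ ⟨a, ha, rfl⟩ τ hτ hτr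
  have hconv : Convex ℝ (ball (u, t) r ∩ s) :=
    (convex_ball _ _).inter (convex_univ.prod (convex_Icc _ _))
  have h1 : (a, t) ∈ ball (u, t) r ∩ s := by
    refine ⟨?_, mem_univ _, ht⟩
    rw [← ball_prod_same]
    exact ⟨ha, mem_ball_self hr⟩
  have h2 : (a, τ) ∈ ball (u, t) r ∩ s := by
    refine ⟨?_, mem_univ _, hτ⟩
    rw [← ball_prod_same]
    exact ⟨ha, by rwa [mem_ball, Real.dist_eq]⟩
  have h3 := hconv.norm_image_sub_le_of_norm_hasFDerivWithin_le' (φ := D) (C := η)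
    (fun p hp => (hd p hp.2).mono inter_subset_right)
    (fun p hp => by have := hball hp; rwa [← dist_eq_norm]) h1 h2
  have h4 : D ((a, τ) - (a, t)) =
      -((τ - t) • f (gaussCurvature (F t) y) • outerNormal (F t) y) := by
    have : ((a, τ) - (a, t) : EuclideanSpace ℝ (Fin n) × ℝ) = (τ - t) • (0, 1) := by
      simp
    rw [this, map_smul, hDt, smul_neg]
  have h5 : ‖((a, τ) - (a, t) : EuclideanSpace ℝ (Fin n) × ℝ)‖ = |τ - t| := by
    simp [Prod.norm_def]
  rw [h4, h5, sub_neg_eq_add] at h3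
  exact h3

theorem IsFlow.hasDerivWithinAt_inner (hF : IsFlow f X₀ T F) (ht₁ : t₁ ∈ timeInterval T) {t : ℝ}
    (ht : t ∈ Icc 0 t₁) {x : Sph n} {z : Amb n} (hz : outerNormal (F t) x = z) (hz1 : ‖z‖ = 1) :
    HasDerivWithinAt (fun τ => ⟪F τ x, z⟫) (-f (gaussCurvature (F t) x)) (Icc 0 t₁) t := by
  have hsub := Icc_subset_timeInterval ht₁
  have h := ((hF.evolution t (hsub ht) x).mono hsub).inner ℝ (hasDerivWithinAt_const t _ z)
  refine h.congr_deriv ?_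
  rw [hz, inner_zero_right, zero_add, inner_neg_left, inner_smul_left, real_inner_self_eq_norm_sq,
    hz1]
  simp

/-- One-sided bound for the time derivative of the support function, from the left. -/
theorem IsFlow.eventually_supportFn_le (hF : IsFlow f X₀ T F) (ht₁ : t₁ ∈ timeInterval T)
    (h0 : 0 < t₁) {t : ℝ} (ht : t ∈ Ioc 0 t₁) {x : Sph n} {z : Amb n} (hz : ‖z‖ = 1)
    (hx : ⟪F t x, z⟫ = supportFn (F t) z) {η : ℝ} (hη : 0 < η) :
    ∀ᶠ τ in 𝓝[<] t, supportFn (F τ) z ≤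
      supportFn (F t) z + (t - τ) * (f (gaussCurvature (F t) x) + η) := by
  have hsub := Icc_subset_timeInterval ht₁
  have htJ : t ∈ Icc 0 t₁ := Ioc_subset_Icc_self ht
  have hX := hF.convex t (hsub htJ)
  have hN := outerNormal_eq_of_inner_eq_supportFn hX hz hx
  obtain ⟨U, hU, r, hr, h⟩ := hF.eventually_norm_sub_le ht₁ h0 htJ x hη
  obtain ⟨V, hVU, hVo, hxV⟩ := _root_.mem_nhds_iff.1 hU
  have hcr := hF.continuous_restrict ht₁
  -- Positive curvature makes x the only contact point in direction z at time t, so by compactness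
  -- maximizers at nearby times lie near x, where the uniform time expansion applies.
  have hfar : ∀ᶠ τ : Icc 0 t₁ in 𝓝 ⟨t, htJ⟩, ∀ y ∈ Vᶜ, ⟪F τ y, z⟫ < ⟪F τ x, z⟫ := by
    refine hVo.isClosed_compl.isCompact.eventually_forall_of_forall_eventually fun y hy => ?_
    have hc1 : Continuous fun p : Icc 0 t₁ × Sph n => F p.1 p.2 :=
      hcr.comp (f := fun p : Icc 0 t₁ × Sph n => (p.2, p.1)) (by fun_prop)
    have hc2 : Continuous fun p : Icc 0 t₁ × Sph n => F p.1 x :=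
      hcr.comp (f := fun p : Icc 0 t₁ × Sph n => (x, p.1)) (by fun_prop)
    have hc : Continuous fun p : Icc 0 t₁ × Sph n => ⟪F p.1 y, z⟫ := by
      have hc3 : Continuous fun p : Icc 0 t₁ × Sph n => F p.1 y :=
        hcr.comp (f := fun p : Icc 0 t₁ × Sph n => (y, p.1)) (by fun_prop)
      exact hc3.inner continuous_const
    refine (((hc1.inner (𝕜 := ℝ) (continuous_const (y := z))).tendsto (⟨t, htJ⟩, y)).eventually_lt
      ((hc2.inner (𝕜 := ℝ) (continuous_const (y := z))).tendsto (⟨t, htJ⟩, y)) ?_)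
    refine lt_of_le_of_ne (by rw [hx]; exact inner_le_supportFn hX.smooth.continuous y z)
      fun h0 => hy ?_
    rw [eq_of_inner_outerNormal_eq_zero hX (hF.curvature_pos t (hsub htJ) x) (y := y)
      (by rw [hN, inner_sub_left]; exact sub_eq_zero.2 h0)]
    exact hxV
  rw [nhds_subtype_eq_comap, eventually_comap] at hfar
  have hball : ∀ᶠ τ in 𝓝[<] t, |τ - t| < r :=
    nhdsWithin_le_nhds (by
    filter_upwards [Metric.ball_mem_nhds t hr] with τ hτ
    rwa [mem_ball, Real.dist_eq] at hτ)
  filter_upwards [nhdsWithin_le_nhds hfar, hball, Ioo_mem_nhdsLT ht.1] with τ h1 h2 h3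
  have hτ : τ ∈ Icc 0 t₁ := ⟨h3.1.le, h3.2.le.trans ht.2⟩
  have hXτ := hF.convex τ (hsub hτ)
  obtain ⟨y, hy⟩ := exists_inner_eq_supportFn hXτ.smooth.continuous z
  have hyV : y ∈ V := by
    by_contra hyV
    have := h1 ⟨τ, hτ⟩ rfl y hyV
    have := inner_le_supportFn hXτ.smooth.continuous x z
    simp only at *
    linarith
  have h4 := h y (hVU hyV) τ hτ h2
  have h5 := (real_inner_le_norm _ z).trans (mul_le_mul_of_nonneg_right h4 (norm_nonneg z))
  rw [hz, mul_one, inner_add_left, inner_sub_left, inner_smul_left, inner_smul_left, hN,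
    real_inner_self_eq_norm_sq, hz, hy, abs_of_neg (by linarith [h3.2])] at h5
  simp only [conj_trivial] at h5
  have h6 := inner_le_supportFn hX.smooth.continuous y z
  linarith

/-- The convex bodies enclosed by the moving hypersurfaces are decreasing. -/
theorem IsFlow.antitoneOn_supportFn (hF : IsFlow f X₀ T F) (hf : ∀ K, 0 < K → 0 < f K)
    (ht₁ : t₁ ∈ timeInterval T) {z : Amb n} (hz : ‖z‖ = 1) :
    AntitoneOn (fun t => supportFn (F t) z) (Icc 0 t₁) := by
  have hsub := Icc_subset_timeInterval ht₁
  refine antitoneOn_of_eventually_left ?_ fun t ht => ?_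
  · rw [continuousOn_iff_continuous_domRestrict]
    exact (hF.continuous_supportFn ht₁).comp (f := fun t : Icc 0 t₁ => (z, t)) (by fun_prop)
  have htJ : t ∈ Icc 0 t₁ := Ioc_subset_Icc_self ht
  have hX := hF.convex t (hsub htJ)
  obtain ⟨x, hx⟩ := exists_inner_eq_supportFn hX.smooth.continuous z
  have hN := outerNormal_eq_of_inner_eq_supportFn hX hz hx
  have hd := hF.hasDerivWithinAt_inner ht₁ htJ hN hz
  have hpos := hf _ (hF.curvature_pos t (hsub htJ) x)
  have hJ : Icc 0 t₁ ∈ 𝓝[<] t := Icc_mem_nhdsLT_of_mem ht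
  have h1 := (hasDerivWithinAt_iff_tendsto_slope' (by simp)).1 (hd.mono_of_mem_nhdsWithin hJ)
  -- The height of the tracked point x is a lower barrier touching the support function at t, with
  -- slope -f(K) < 0; hence the support function is larger just before t.
  filter_upwards [h1.eventually (gt_mem_nhds (neg_lt_zero.2 hpos)), self_mem_nhdsWithin, hJ]
    with τ h2 h3 h4
  have h5 : τ < t := h3
  rw [slope_def_field, div_neg_iff] at h2
  have h6 := inner_le_supportFn (hF.convex τ (hsub h4)).smooth.continuous x z
  rcases h2 with h2 | h2 <;> linarith

end Flow

/-! ### Growth of the speed function and the algebraic contradiction. -/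

section Speed

variable {n : ℕ} {f : ℝ → ℝ}

theorem SpeedCondition.hasDerivAt (hf : SpeedCondition n f) {K : ℝ} (hK : 0 < K) :
    HasDerivAt f (deriv f K) K :=
  ((hf.smooth.contDiffAt (Ioi_mem_nhds hK)).differentiableAt (by simp)).hasDerivAt

theorem SpeedCondition.monotoneOn (hf : SpeedCondition n f) : MonotoneOn f (Ioi 0) := by
  refine monotoneOn_of_deriv_nonneg (convex_Ioi 0) hf.smooth.continuousOn ?_ ?_
  · rw [interior_Ioi]
    exact fun K hK => (hf.hasDerivAt hK).differentiableAt.differentiableWithinAt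
  · rw [interior_Ioi]
    exact fun K hK => (hf.deriv_pos K hK).le

theorem SpeedCondition.le_mul_deriv (hf : SpeedCondition n f) {K : ℝ} (hK : 0 < K) :
    f K ≤ n * K * deriv f K := by
  obtain ⟨α₁, α₂, h1, -, -, h⟩ := hf.homogeneity
  have h2 := (h K hK).1
  have h3 := hf.pos K hK
  rw [le_div_iff₀ h3] at h2
  nlinarith

/-- The function `κ ↦ f (κ ^ n) / κ` is nondecreasing. -/
theorem SpeedCondition.mul_le_mul (hn : 0 < n) (hf : SpeedCondition n f) {κ κ' : ℝ} (hκ : 0 < κ)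
    (h : κ ≤ κ') : f (κ ^ n) * κ' ≤ f (κ' ^ n) * κ := by
  have hd : ∀ κ ∈ Ioi (0 : ℝ), HasDerivAt (fun κ => f (κ ^ n) / κ)
      ((deriv f (κ ^ n) * (n * κ ^ (n - 1)) * κ - f (κ ^ n) * 1) / κ ^ 2) κ := fun κ hκ =>
    ((hf.hasDerivAt (pow_pos hκ n)).comp κ (hasDerivAt_pow n κ)).div (hasDerivAt_id κ)
      (ne_of_gt hκ)
  have hm : MonotoneOn (fun κ => f (κ ^ n) / κ) (Ioi 0) := by
    refine monotoneOn_of_deriv_nonneg (convex_Ioi 0)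
      (fun κ hκ => (hd κ hκ).continuousAt.continuousWithinAt) ?_ ?_
    · rw [interior_Ioi]
      exact fun κ hκ => (hd κ hκ).differentiableAt.differentiableWithinAt
    · rw [interior_Ioi]
      intro κ hκ
      rw [(hd κ hκ).deriv]
      have h1 := hf.le_mul_deriv (pow_pos hκ n)
      have h2 : κ ^ (n - 1) * κ = κ ^ n := pow_sub_one_mul hn.ne' κ
      refine div_nonneg ?_ (sq_nonneg κ)
      have h3 : deriv f (κ ^ n) * (n * κ ^ (n - 1)) * κ = n * κ ^ n * deriv f (κ ^ n) := by
        rw [← h2]; ring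
      linarith
  have hκ' : 0 < κ' := hκ.trans_le h
  have := hm hκ hκ' h
  simp only at this
  rwa [div_le_div_iff₀ hκ hκ'] at this

theorem exists_pow_eq (hn : 0 < n) {K : ℝ} (hK : 0 < K) : ∃ κ : ℝ, 0 < κ ∧ κ ^ n = K :=
  ⟨K ^ ((n : ℝ)⁻¹), Real.rpow_pos_of_pos hK _, Real.rpow_inv_natCast_pow hK.le hn.ne'⟩

/-- The geometric comparison forces κ₁ to exceed κ₀ by the factor 1/(2 - ρ), while the growth of f
allows at most the factor ρ. -/
theorem SpeedCondition.not_comparison (hn : 0 < n) (hf : SpeedCondition n f) {κ₀ κ₁ ρ δ : ℝ}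
    (h0 : 0 < κ₀) (h1 : 0 < κ₁) (hρ : 1 < ρ) (hδ : 2 ≤ δ * κ₀)
    (h : κ₀ ^ n / κ₁ ^ n ≤ (ρ - (ρ - 1) * δ * κ₀) ^ n) (h' : 0 ≤ ρ - (ρ - 1) * δ * κ₀)
    (hfρ : f (κ₁ ^ n) ≤ ρ * f (κ₀ ^ n)) : False := by
  rw [← div_pow] at h
  have h2 : κ₀ / κ₁ ≤ 2 - ρ := by
    have := le_of_pow_le_pow_left₀ hn.ne' h' h
    nlinarith
  rw [div_le_iff₀ h1] at h2
  have h3 : κ₀ ≤ κ₁ := by nlinarith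
  have h4 := hf.mul_le_mul hn h0 h3
  have hf0 := hf.pos _ (pow_pos h0 n)
  have h5 : κ₁ ≤ ρ * κ₀ := by
    have : f (κ₀ ^ n) * κ₁ ≤ f (κ₀ ^ n) * (ρ * κ₀) := by nlinarith
    exact le_of_mul_le_mul_left this hf0
  -- Impossible, since ρ(2 - ρ) = 1 - (ρ - 1)² < 1.
  have h6 : κ₁ ≤ ρ * (2 - ρ) * κ₁ := by nlinarith
  nlinarith [mul_pos (mul_pos (sub_pos.2 hρ) (sub_pos.2 hρ)) h1]

end Speed

/-! ### Two-point maximum principle in time. -/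

section MaximumPrinciple

variable {n : ℕ} {f : ℝ → ℝ} {X₀ : Sph n → Amb n} {T : EReal} {F : ℝ → Sph n → Amb n} {t₁ : ℝ}

theorem IsFlow.supportFn_sub_ge (hF : IsFlow f X₀ T F) (hf : ∀ K, 0 < K → 0 < f K)
    (ht₁ : t₁ ∈ timeInterval T) {r : ℝ} (hr : 0 ≤ r) {c : Amb n}
    (hball : closedBall c r ⊆ enclosedBody (F t₁)) {z : Amb n} (hz : ‖z‖ = 1) {t : ℝ}
    (ht : t ∈ Icc 0 t₁) : r ≤ supportFn (F t) z - ⟪c, z⟫ := by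
  have h1 := le_supportFn_of_closedBall_subset (hF.convex t₁ ht₁).smooth.continuous hr hball hz
  have h2 := hF.antitoneOn_supportFn hf ht₁ hz ht ⟨ht₁.1, le_rfl⟩ ht.2
  simp only at h2
  linarith

/-- The quantity whose monotonicity in time is equivalent to the speed bound. -/
def weightedSupport (F : ℝ → Sph n → Amb n) (c : Amb n) (δ L : ℝ) (z : Amb n) (t : ℝ) : ℝ :=
  (supportFn (F t) z - ⟪c, z⟫ - δ) * Real.exp (L * t)

theorem hasDerivAt_exp_mul (L t : ℝ) :
    HasDerivAt (fun τ => Real.exp (L * τ)) (Real.exp (L * t) * L) t := by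
  simpa using ((hasDerivAt_id t).const_mul L).exp

theorem IsFlow.hasDerivWithinAt_lower_barrier (hF : IsFlow f X₀ T F) (ht₁ : t₁ ∈ timeInterval T)
    {t : ℝ} (ht : t ∈ Icc 0 t₁) {x : Sph n} {z : Amb n} (hz : ‖z‖ = 1)
    (hN : outerNormal (F t) x = z) (c : Amb n) (δ L : ℝ) :
    HasDerivWithinAt (fun τ => (⟪F τ x, z⟫ - ⟪c, z⟫ - δ) * Real.exp (L * τ))
      ((L * (⟪F t x, z⟫ - ⟪c, z⟫ - δ) - f (gaussCurvature (F t) x)) * Real.exp (L * t))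
      (Icc 0 t₁) t := by
  have h := (((hF.hasDerivWithinAt_inner ht₁ ht hN hz).sub_const ⟪c, z⟫).sub_const δ).mul
    (hasDerivAt_exp_mul L t).hasDerivWithinAt
  refine h.congr_deriv ?_
  ring

/-- At a time where the weighted support function in a fixed direction is minimal among earlier
times, the speed is large. -/
theorem IsFlow.le_speed_of_min (hF : IsFlow f X₀ T F) (ht₁ : t₁ ∈ timeInterval T) (h0 : 0 < t₁)
    {t : ℝ} (ht : t ∈ Ioc 0 t₁) {x : Sph n} {z : Amb n} (hz : ‖z‖ = 1)
    (hx : ⟪F t x, z⟫ = supportFn (F t) z) {c : Amb n} {δ L : ℝ}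
    (hmin : ∀ᶠ τ in 𝓝[<] t, weightedSupport F c δ L z t ≤ weightedSupport F c δ L z τ) :
    L * (supportFn (F t) z - ⟪c, z⟫ - δ) ≤ f (gaussCurvature (F t) x) := by
  refine le_of_forall_pos_le_add fun η hη => ?_
  set f₀ := f (gaussCurvature (F t) x)
  set S := supportFn (F t) z - ⟪c, z⟫ - δ with hS
  -- An explicit upper barrier for the weighted support function to the left of t, equal to it at t;
  -- the slack η stands in for differentiability of the support function.
  have hd : HasDerivAt (fun τ => -((S + (t - τ) * (f₀ + η)) * Real.exp (L * τ)))
      (-((0 + (0 - 1) * (f₀ + η)) * Real.exp (L * t) +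
        (S + (t - t) * (f₀ + η)) * (Real.exp (L * t) * L))) t :=
    (((hasDerivAt_const t S).add ((((hasDerivAt_const t t).sub (hasDerivAt_id t))).mul_const
      (f₀ + η))).mul (hasDerivAt_exp_mul L t)).neg
  have h1 := nonneg_of_hasDerivWithinAt_of_le (s := Iio t) self_mem_nhdsWithin
    hd.hasDerivWithinAt (by
      filter_upwards [hmin, hF.eventually_supportFn_le ht₁ h0 ht hz hx hη] with τ h2 h3
      unfold weightedSupport at h2
      rw [sub_self, zero_mul, add_zero]
      refine neg_le_neg (h2.trans ?_)
      refine mul_le_mul_of_nonneg_right ?_ (Real.exp_pos _).le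
      rw [hS]
      linarith)
  have h2 : 0 ≤ (f₀ + η - L * S) * Real.exp (L * t) := by
    refine h1.trans (le_of_eq ?_)
    ring
  linarith [nonneg_of_mul_nonneg_left h2 (Real.exp_pos _)]

theorem IsFlow.continuous_weightedSupport (hF : IsFlow f X₀ T F) (ht₁ : t₁ ∈ timeInterval T)
    (c : Amb n) (δ L : ℝ) :
    Continuous fun p : Amb n × Icc 0 t₁ => weightedSupport F c δ L p.1 p.2 := by
  have := hF.continuous_supportFn ht₁
  unfold weightedSupport
  fun_prop

/-- The weighted support functions do not decrease in time. -/
theorem IsFlow.weightedSupport_mono (hn : 0 < n) (hf : SpeedCondition n f) (hF : IsFlow f X₀ T F)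
    (ht₁ : t₁ ∈ timeInterval T) (h0 : 0 < t₁) {δ L : ℝ} (hδ : 0 < δ) (hL : 0 < L) {c : Amb n}
    (hball : closedBall c (2 * δ) ⊆ enclosedBody (F t₁))
    (hL₀ : ∀ x, f (gaussCurvature (F 0) x) < L * δ)
    (hL₁ : ∀ κ : ℝ, 0 < κ → L * δ ≤ f (κ ^ n) → 2 ≤ δ * κ)
    {z : Amb n} (hz : ‖z‖ = 1) {a b : ℝ} (ha : a ∈ Icc 0 t₁) (hb : b ∈ Icc 0 t₁) (hab : a ≤ b) :
    weightedSupport F c δ L z a ≤ weightedSupport F c δ L z b := by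
  have hsub := Icc_subset_timeInterval ht₁
  have hge : ∀ {z : Amb n}, ‖z‖ = 1 → ∀ {t}, t ∈ Icc 0 t₁ →
      δ ≤ supportFn (F t) z - ⟪c, z⟫ - δ := fun hz _ ht => by
    have := hF.supportFn_sub_ge hf.pos ht₁ (by positivity) hball hz ht
    linarith
  have hgpos : ∀ {z : Amb n}, ‖z‖ = 1 → ∀ {t}, t ∈ Icc 0 t₁ →
      0 < weightedSupport F c δ L z t := fun hz _ ht =>
    mul_pos (hδ.trans_le (hge hz ht)) (Real.exp_pos _)
  by_contra! hlt
  have hgc := hF.continuous_weightedSupport ht₁ c δ L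
  -- Failure of monotonicity means that R exceeds 1 somewhere on the compact set of directions and
  -- ordered pairs of times, hence at its maximum.
  let R : Sph n × Icc 0 t₁ × Icc 0 t₁ → ℝ := fun p =>
    weightedSupport F c δ L p.1 p.2.1 / weightedSupport F c δ L p.1 p.2.2
  have hRc : Continuous R := by
    refine Continuous.div
      (hgc.comp (f := fun p : Sph n × Icc 0 t₁ × Icc 0 t₁ => ((p.1 : Amb n), p.2.1)) (by fun_prop))
      (hgc.comp (f := fun p : Sph n × Icc 0 t₁ × Icc 0 t₁ => ((p.1 : Amb n), p.2.2)) (by fun_prop))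
      fun p => (hgpos (norm_eq_of_mem_sphere p.1) p.2.2.2).ne'
  have hclosed : IsClosed {p : Sph n × Icc 0 t₁ × Icc 0 t₁ | p.2.1 ≤ p.2.2} :=
    isClosed_le (by fun_prop) (by fun_prop)
  obtain ⟨⟨⟨z₀, hz₀⟩, ⟨a₀, ha₀⟩, ⟨b₀, hb₀⟩⟩, hab₀, hmax⟩ :=
    hclosed.isCompact.exists_isMaxOn
      ⟨(⟨z, by simpa using hz⟩, ⟨a, ha⟩, ⟨b, hb⟩), hab⟩ hRc.continuousOn
  have hab₀ : a₀ ≤ b₀ := hab₀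
  have hz₀1 : ‖z₀‖ = 1 := by simpa using hz₀
  have hmax' : ∀ z' : Amb n, ‖z'‖ = 1 → ∀ a' ∈ Icc 0 t₁, ∀ b' ∈ Icc 0 t₁, a' ≤ b' →
      weightedSupport F c δ L z' a' / weightedSupport F c δ L z' b' ≤
        weightedSupport F c δ L z₀ a₀ / weightedSupport F c δ L z₀ b₀ :=
    fun z' hz' a' ha' b' hb' hab' =>
      hmax (a := (⟨z', by simpa using hz'⟩, ⟨a', ha'⟩, ⟨b', hb'⟩)) hab'
  have hR : weightedSupport F c δ L z₀ b₀ < weightedSupport F c δ L z₀ a₀ := by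
    have h1 := hmax' z hz a ha b hb hab
    have h2 := ((one_lt_div (hgpos hz hb)).2 hlt).trans_le h1
    exact (one_lt_div (hgpos hz₀1 hb₀)).1 h2
  have hlt₀ : a₀ < b₀ := lt_of_le_of_ne hab₀ (by rintro rfl; exact lt_irrefl _ hR)
  have hamax : ∀ τ ∈ Icc 0 t₁, τ ≤ b₀ →
      weightedSupport F c δ L z₀ τ ≤ weightedSupport F c δ L z₀ a₀ := fun τ hτ hτb =>
    (div_le_div_iff_of_pos_right (hgpos hz₀1 hb₀)).1 (hmax' z₀ hz₀1 τ hτ b₀ hb₀ hτb)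
  have hbmin : ∀ τ ∈ Icc 0 t₁, a₀ ≤ τ →
      weightedSupport F c δ L z₀ b₀ ≤ weightedSupport F c δ L z₀ τ := fun τ hτ hτa =>
    (div_le_div_iff_of_pos_left (hgpos hz₀1 ha₀) (hgpos hz₀1 hτ) (hgpos hz₀1 hb₀)).1
      (hmax' z₀ hz₀1 a₀ ha₀ τ hτ hτa)
  have hX := hF.convex b₀ (hsub hb₀)
  have hY := hF.convex a₀ (hsub ha₀)
  obtain ⟨x, hx⟩ := exists_inner_eq_supportFn hX.smooth.continuous z₀
  obtain ⟨y, hy⟩ := exists_inner_eq_supportFn hY.smooth.continuous z₀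
  have hNx := outerNormal_eq_of_inner_eq_supportFn hX hz₀1 hx
  have hNy := outerNormal_eq_of_inner_eq_supportFn hY hz₀1 hy
  have hKx := hF.curvature_pos b₀ (hsub hb₀) x
  have hKy := hF.curvature_pos a₀ (hsub ha₀) y
  set S₀ := supportFn (F b₀) z₀ - ⟪c, z₀⟫ - δ with hS₀
  set S₁ := supportFn (F a₀) z₀ - ⟪c, z₀⟫ - δ with hS₁
  have hS₀δ : δ ≤ S₀ := hge hz₀1 hb₀
  have hS₁δ : δ ≤ S₁ := hge hz₀1 ha₀
  have hS₀pos : 0 < S₀ := hδ.trans_le hS₀δ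
  -- time derivative at the earlier time
  have hφle : ∀ τ ∈ Icc 0 t₁, τ ≤ b₀ → (⟪F τ y, z₀⟫ - ⟪c, z₀⟫ - δ) * Real.exp (L * τ) ≤
      (⟪F a₀ y, z₀⟫ - ⟪c, z₀⟫ - δ) * Real.exp (L * a₀) := by
    intro τ hτ hτb
    rw [hy]
    refine le_trans ?_ (hamax τ hτ hτb)
    refine mul_le_mul_of_nonneg_right ?_ (Real.exp_pos _).le
    have := inner_le_supportFn (hF.convex τ (hsub hτ)).smooth.continuous y z₀
    linarith
  have hφd := hF.hasDerivWithinAt_lower_barrier ht₁ ha₀ hz₀1 hNy c δ L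
  -- At time 0 the initial speed is below Lδ ≤ L S₁, so the weighted height of y would increase
  -- initially, against maximality of a₀.
  have ha0 : 0 < a₀ := by
    refine lt_of_le_of_ne ha₀.1 ?_
    rintro rfl
    have hr := nonpos_of_hasDerivWithinAt_of_le (Icc_mem_nhdsGT h0) hφd (by
      filter_upwards [Ioo_mem_nhdsGT hlt₀] with τ hτ
      exact hφle τ ⟨hτ.1.le, hτ.2.le.trans hb₀.2⟩ hτ.2.le)
    rw [hy] at hr
    have h1 := nonpos_of_mul_nonpos_left hr (Real.exp_pos _)
    have h2 := hL₀ y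
    have h3 : L * δ ≤ L * S₁ := by gcongr
    linarith
  have hf₁ : f (gaussCurvature (F a₀) y) ≤ L * S₁ := by
    have hl := nonneg_of_hasDerivWithinAt_of_le (Icc_mem_nhdsLT_of_mem ⟨ha0, ha₀.2⟩) hφd (by
      filter_upwards [Ioo_mem_nhdsLT ha0] with τ hτ
      exact hφle τ ⟨hτ.1.le, hτ.2.le.trans ha₀.2⟩ (hτ.2.le.trans hab₀))
    rw [hy] at hl
    linarith [nonneg_of_mul_nonneg_left hl (Real.exp_pos _)]
  -- time derivative at the later time
  have hf₀ : L * S₀ ≤ f (gaussCurvature (F b₀) x) := by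
    refine hF.le_speed_of_min ht₁ h0 ⟨ha0.trans hlt₀, hb₀.2⟩ hz₀1 hx ?_
    filter_upwards [Ioo_mem_nhdsLT hlt₀] with τ hτ
    exact hbmin τ ⟨ha₀.1.trans hτ.1.le, hτ.2.le.trans hb₀.2⟩ hτ.1.le
  have hS : S₀ < S₁ := by
    have h1 : S₀ * Real.exp (L * a₀) < S₁ * Real.exp (L * a₀) := by
      refine lt_of_le_of_lt ?_ hR
      change _ ≤ S₀ * Real.exp (L * b₀)
      gcongr
    exact lt_of_mul_lt_mul_right h1 (Real.exp_pos _).le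
  set ρ := S₁ / S₀ with hρ
  have hρ1 : 1 < ρ := (one_lt_div hS₀pos).2 hS
  have hρS : ρ * S₀ = S₁ := div_mul_cancel₀ _ hS₀pos.ne'
  -- Varying only the direction keeps both times fixed, so the exponential factors cancel from the
  -- maximality of R.
  have hspace : ∀ z' : Amb n, ‖z'‖ = 1 → supportFn (F a₀) z' - ⟪c, z'⟫ - δ ≤
      ρ * (supportFn (F b₀) z' - ⟪c, z'⟫ - δ) := by
    intro z' hz'
    have h1 := hmax' z' hz' a₀ ha₀ b₀ hb₀ hab₀
    unfold weightedSupport at h1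
    rw [mul_div_mul_comm, mul_div_mul_comm] at h1
    have h2 := le_of_mul_le_mul_right h1 (div_pos (Real.exp_pos _) (Real.exp_pos _))
    rwa [div_le_iff₀ (hδ.trans_le (hge hz' hb₀))] at h2
  obtain ⟨κ₀, hκ₀, hκ₀n⟩ := exists_pow_eq hn hKx
  obtain ⟨κ₁, hκ₁, hκ₁n⟩ := exists_pow_eq hn hKy
  have hcomp := touching_comparison hn hX hY hKx hKy hNx hNy (c := c) (ρ := ρ)
    (μ := (ρ - 1) * δ) (by linarith) (mul_nonneg (by linarith) hδ.le) hκ₀n ?_ ?_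
  · rw [← hκ₁n] at hcomp
    rw [← hκ₀n] at hf₀
    rw [← hκ₁n] at hf₁
    refine hf.not_comparison hn hκ₀ hκ₁ hρ1 (hL₁ κ₀ hκ₀ ?_) hcomp.1 hcomp.2 ?_
    · exact le_trans (by gcongr) hf₀
    · calc f (κ₁ ^ n) ≤ L * S₁ := hf₁
        _ = ρ * (L * S₀) := by rw [← hρS]; ring
        _ ≤ ρ * f (κ₀ ^ n) := by gcongr
  -- `touching_comparison` tests with vectors z + εa that are not unit, so the inequality is
  -- extended by homogeneity; this is why the shift carries the factor ‖ζ‖.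
  · intro y' ζ
    rcases eq_or_ne ζ 0 with rfl | hζ
    · exact ⟨x, by simp⟩
    have hζ' : 0 < ‖ζ‖ := norm_pos_iff.2 hζ
    set z' := ‖ζ‖⁻¹ • ζ with hz'
    have hz'1 : ‖z'‖ = 1 := by rw [hz', norm_smul, norm_inv, norm_norm, inv_mul_cancel₀ hζ'.ne']
    have hζz : ζ = ‖ζ‖ • z' := by rw [hz', smul_smul, mul_inv_cancel₀ hζ'.ne', one_smul]
    obtain ⟨x', hx'⟩ := exists_inner_eq_supportFn hX.smooth.continuous z'
    refine ⟨x', ?_⟩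
    have h1 := hspace z' hz'1
    have h2 := inner_le_supportFn hY.smooth.continuous y' z'
    rw [← hx'] at h1
    have h3 : ⟪F a₀ y' - c, z'⟫ ≤ ρ * ⟪F b₀ x' - c, z'⟫ - (ρ - 1) * δ := by
      rw [inner_sub_left, inner_sub_left]
      linarith
    have e : ∀ p : Amb n, ⟪p, ζ⟫ = ‖ζ‖ * ⟪p, z'⟫ := fun p => by
      conv_lhs => rw [hζz]
      rw [inner_smul_right]
    rw [e, e]
    have := mul_le_mul_of_nonneg_left h3 hζ'.le
    linarith
  · rw [inner_sub_left, inner_sub_left, hx, hy]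
    linarith

/-- The speed is bounded by a multiple of the support function. -/
theorem IsFlow.speed_le (hn : 0 < n) (hf : SpeedCondition n f) (hF : IsFlow f X₀ T F)
    (ht₁ : t₁ ∈ timeInterval T) (h0 : 0 < t₁) {δ L : ℝ} (hδ : 0 < δ) (hL : 0 < L) {c : Amb n}
    (hball : closedBall c (2 * δ) ⊆ enclosedBody (F t₁))
    (hL₀ : ∀ x, f (gaussCurvature (F 0) x) < L * δ)
    (hL₁ : ∀ κ : ℝ, 0 < κ → L * δ ≤ f (κ ^ n) → 2 ≤ δ * κ) (x : Sph n) :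
    f (gaussCurvature (F t₁) x) ≤
      L * (⟪F t₁ x, outerNormal (F t₁) x⟫ - ⟪c, outerNormal (F t₁) x⟫ - δ) := by
  have hX := hF.convex t₁ ht₁
  have hz := (outerNormal_spec hX x).1
  have hmem : t₁ ∈ Icc 0 t₁ := ⟨h0.le, le_rfl⟩
  have hd := hF.hasDerivWithinAt_lower_barrier ht₁ hmem hz rfl c δ L
  -- The weighted height of the fixed point x lies below the weighted support function, which is
  -- nondecreasing, and meets it at t₁; so its left derivative there is nonnegative.
  have h1 := nonneg_of_hasDerivWithinAt_of_le (Icc_mem_nhdsLT h0) hd (by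
    filter_upwards [Ioo_mem_nhdsLT h0] with τ hτ
    have hτJ : τ ∈ Icc 0 t₁ := Ioo_subset_Icc_self hτ
    have h2 := hF.weightedSupport_mono hn hf ht₁ h0 hδ hL hball hL₀ hL₁ hz hτJ hmem hτ.2.le
    rw [inner_outerNormal_eq_supportFn hX]
    refine le_trans ?_ h2
    refine mul_le_mul_of_nonneg_right ?_ (Real.exp_pos _).le
    have := inner_le_supportFn
      (hF.convex τ (Icc_subset_timeInterval ht₁ hτJ)).smooth.continuous x (outerNormal (F t₁) x)
    linarith)
  linarith [nonneg_of_mul_nonneg_left h1 (Real.exp_pos _)]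

end MaximumPrinciple

/-! ### Homotheties of convex hypersurfaces. -/

section Scaling

variable {n : ℕ} {X : Sph n → Amb n}

theorem IsConvexHypersurface.smul (hX : IsConvexHypersurface X) {s : ℝ} (hs : 0 < s) :
    IsConvexHypersurface fun x => s • X x := by
  open scoped Pointwise in
  have hr : range (fun x => s • X x) = s • range X := by
    rw [← image_smul, ← range_comp]; rfl
  open scoped Pointwise in
  have hb : enclosedBody (fun x => s • X x) = s • enclosedBody X := by
    rw [enclosedBody, hr, convexHull_smul, enclosedBody]
  refine ⟨(contDiff_const_smul s).comp_contMDiff hX.smooth,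
    fun x y h => hX.injective (smul_right_injective _ hs.ne' h), fun x => ?_, ?_, ?_⟩
  · have hc : coordD (fun x => s • X x) x = fun i => s • coordD X x i := by
      ext1 i
      have hd := ((localRep_contDiff hX.smooth x).differentiable (by simp)
        (extChartAt (𝓡 n) x x)).hasFDerivAt.const_smul s
      change fderiv ℝ (s • localRep X x) _ _ = _
      rw [hd.fderiv]
      rfl
    rw [hc]
    exact (hX.immersion x).units_smul fun _ => Units.mk0 s hs.ne'
  · rw [hb, interior_smul₀ hs.ne']
    exact hX.interior_nonempty.smul_set
  · rw [hb, hr, hX.range_eq]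
    exact ((Homeomorph.smulOfNeZero s hs.ne').image_frontier _)

end Scaling

/-! ### Choice of constants and conclusion. -/

theorem exists_closedBall_subset_of_lt_innerRadius {n : ℕ} {Ω : Set (Amb n)} {r : ℝ}
    (hr : 0 ≤ r) (h : r < innerRadius Ω) : ∃ c, closedBall c r ⊆ Ω := by
  have hne : {r : ℝ | 0 ≤ r ∧ ∃ c, closedBall c r ⊆ Ω}.Nonempty := by
    by_contra hne
    rw [innerRadius, not_nonempty_iff_eq_empty.1 hne, Real.sSup_empty] at h
    exact absurd h (not_lt.2 hr)
  obtain ⟨r', ⟨-, c, hc⟩, hlt⟩ := exists_lt_of_lt_csSup hne h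
  exact ⟨c, (closedBall_subset_closedBall hlt.le).trans hc⟩

theorem exists_curvature_bound {n : ℕ} (hn : 0 < n) {f : ℝ → ℝ} (hf : SpeedCondition n f)
    {X₀ : Sph n → Amb n} (hX₀ : IsConvexHypersurface X₀) {r₀ : ℝ} (hr₀ : 0 < r₀) :
    ∃ C : ℝ, 0 < C ∧ ∀ (T : EReal) (F : ℝ → Sph n → Amb n), IsFlow f X₀ T F →
      (∀ t ∈ timeInterval T, r₀ ≤ innerRadius (enclosedBody (F t))) →
        ∀ t ∈ timeInterval T, ∀ x, gaussCurvature (F t) x ≤ C := by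
  obtain ⟨B, hB⟩ := exists_gaussCurvature_le hn hX₀
  obtain ⟨R, hR⟩ := (isCompact_range hX₀.smooth.continuous).isBounded.exists_norm_le
  have hRx : ∀ x, ‖X₀ x‖ ≤ R := fun x => hR _ (mem_range_self x)
  have hR0 : 0 ≤ R := (norm_nonneg _).trans (hRx (Classical.arbitrary _))
  -- The inner radius is a supremum that need not be known to be attained; 2δ = r₀/2 lies strictly
  -- below it, so a ball of radius 2δ exists.
  set δ := r₀ / 4 with hδ
  have hδ0 : 0 < δ := by positivity
  have hM : 0 < f (max B 1) := hf.pos _ (by positivity)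
  have hM' : 0 < f ((2 / δ) ^ n) := hf.pos _ (by positivity)
  have hf1 : 0 < f 1 := hf.pos _ one_pos
  -- The first summand makes Lδ exceed all initial speeds; the second forces κ ≥ 2/δ whenever f(κⁿ)
  -- ≥ Lδ.
  set L := (f (max B 1) + f ((2 / δ) ^ n)) / δ with hL
  have hL0 : 0 < L := by positivity
  have hLδ : L * δ = f (max B 1) + f ((2 / δ) ^ n) := div_mul_cancel₀ _ hδ0.ne'
  refine ⟨max B 1 + (L * (2 * R) / f 1) ^ n, by positivity, ?_⟩
  intro T F hF hrad t ht x
  have hpow : 0 ≤ (L * (2 * R) / f 1) ^ n := by positivity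
  -- The maximum principle needs an interval of positive length; at time 0 the initial curvature
  -- bound suffices.
  rcases eq_or_lt_of_le ht.1 with rfl | ht0
  · rw [hF.initial]
    exact (hB x).trans ((le_max_left B 1).trans (le_add_of_nonneg_right hpow))
  have hX := hF.convex t ht
  obtain ⟨c, hc⟩ := exists_closedBall_subset_of_lt_innerRadius (by positivity)
    (lt_of_lt_of_le (by rw [hδ]; linarith : 2 * δ < r₀) (hrad t ht))
  have hspeed := hF.speed_le hn hf ht ht0 hδ0 hL0 hc (fun y => ?_) (fun κ hκ h => ?_) x
  · set z := outerNormal (F t) x with hz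
    have hz1 : ‖z‖ = 1 := (outerNormal_spec hX x).1
    have hsupp : ∀ z : Amb n, ‖z‖ = 1 → supportFn (F t) z ≤ R := by
      intro z hz1
      have h1 := hF.antitoneOn_supportFn hf.pos ht hz1 ⟨le_rfl, ht.1⟩ ⟨ht.1, le_rfl⟩ ht.1
      refine h1.trans ?_
      obtain ⟨y, hy⟩ := exists_inner_eq_supportFn hX₀.smooth.continuous z
      simp only [hF.initial]
      rw [← hy]
      refine (real_inner_le_norm _ _).trans ?_
      rw [hz1, mul_one]
      exact hRx y
    have h1 : ⟪F t x, z⟫ ≤ R := (inner_le_supportFn hX.smooth.continuous x z).trans (hsupp z hz1)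
    -- The centre c depends on t, but it lies in the body, so the support function in direction -z
    -- bounds it uniformly.
    have h2 : -⟪c, z⟫ ≤ R := by
      rw [← inner_neg_right]
      exact (inner_le_supportFn_of_mem hX.smooth.continuous
        (hc (mem_closedBall_self (by positivity))) (-z)).trans (hsupp (-z) (by rwa [norm_neg]))
    have h3 : f (gaussCurvature (F t) x) ≤ L * (2 * R) := by
      refine hspeed.trans ?_
      gcongr
      linarith
    obtain ⟨κ, hκ, hκn⟩ := exists_pow_eq hn (hF.curvature_pos t ht x)
    rw [← hκn] at h3 ⊢
    rcases le_total κ 1 with h4 | h4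
    · exact (pow_le_one₀ hκ.le h4).trans
        ((le_max_right B 1).trans (le_add_of_nonneg_right hpow))
    · have h5 := hf.mul_le_mul hn one_pos h4
      rw [one_pow, mul_one] at h5
      have h6 : κ ≤ L * (2 * R) / f 1 := by
        rw [le_div_iff₀ hf1]
        linarith
      exact (pow_le_pow_left₀ hκ.le h6 n).trans (le_add_of_nonneg_left (by positivity))
  · rw [hLδ]
    have hpos : 0 < gaussCurvature (F 0) y := hF.curvature_pos 0
      (Icc_subset_timeInterval ht ⟨le_rfl, ht.1⟩) y
    have h1 : gaussCurvature (F 0) y ≤ max B 1 := by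
      rw [hF.initial]; exact (hB y).trans (le_max_left _ _)
    have := hf.monotoneOn hpos (hpos.trans_le h1) h1
    linarith
  · by_contra! hlt
    have h1 : κ < 2 / δ := by rw [lt_div_iff₀ hδ0]; linarith
    have h2 := hf.monotoneOn (pow_pos hκ n) (pow_pos (hκ.trans h1) n)
      (pow_le_pow_left₀ hκ.le h1.le n)
    linarith

end GaussFlow

end

theorem lemma5p4 (n : ℕ) (hn : 2 ≤ n) (f : ℝ → ℝ) (hf : GaussFlow.SpeedCondition n f)
    (F₀ : GaussFlow.Sph n → GaussFlow.Amb n)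
    (hF₀ : GaussFlow.IsStrictlyConvexHypersurface F₀)
    (ϑ : ℝ) (hϑ : 0 < ϑ) (r₀ : ℝ) (hr₀ : 0 < r₀) :
    ∃ C : ℝ, 0 < C ∧
      ∀ (T : EReal) (F : ℝ → GaussFlow.Sph n → GaussFlow.Amb n),
        0 < T →
        GaussFlow.IsFlow f (fun x => ϑ • F₀ x) T F →
        (∀ t ∈ GaussFlow.timeInterval T,
          r₀ ≤ GaussFlow.innerRadius (GaussFlow.enclosedBody (F t))) →
        ∀ t ∈ GaussFlow.timeInterval T, ∀ x : GaussFlow.Sph n,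
          GaussFlow.gaussCurvature (F t) x ≤ C := by
  obtain ⟨C, hC, h⟩ := GaussFlow.exists_curvature_bound (by omega) hf
    (hF₀.toIsConvexHypersurface.smul hϑ) hr₀
  exact ⟨C, hC, fun T F _ hF hrad => h T F hF hrad⟩
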